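/- **Theorem 1.4.** Let $(p_i)_{i\ge 1}$ be real numbers with $0\le p_i\le 1$ and $\sum_{i\ge 1} p_i<\infty$. For each $n\in\mathbb N$ let $M_n=(\{0,\dots,n-1\},<,R)$ be the random structure in which $<$ is the usual order and $R$ is a random graph (a symmetric irreflexive relation) on $\{0,\dots,n-1\}$ such that each pair $i<j$ is an edge with probability $p_{j-i}$, independently for different pairs; that is, a graph $R$ is drawn with probability $$\prod_{i<j<n,\ iRj}p_{j-i}\cdot\prod_{i<j<n,\ \neg\, iRj}(1-p_{j-i}).$$ Then this model satisfies the very weak 0-1 law for first-order logic: for every first-order sentence $\psi$ (with equality) in the vocabulary $\{<,R\}$, $$\mathrm{Prob}(M_{n+1}\models\psi)-\mathrm{Prob}(M_n\models\psi)\longrightarrow 0\qquad\text{as } n\to\infty.$$ -/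

import Mathlib

namespace OrderedRandomGraph

/-- The relation symbols of the vocabulary `{<, R}`: two binary predicates. -/
inductive Rel : ℕ → Type
  | lt : Rel 2
  | edge : Rel 2

/-- The first-order vocabulary `{<, R}` (no function symbols or constants). -/
def language : FirstOrder.Language.{0, 0} := ⟨fun _ => Empty, Rel⟩

/-- The model `(n, <, R)`: the universe is `{0, …, n-1}`, the symbol `<` is interpreted by the usual
order, and `R` by the adjacency relation of the graph `G`. -/
@[reducible] def model {n : ℕ} (G : SimpleGraph (Fin n)) : language.Structure (Fin n) where
  funMap := fun f _ => Empty.elim f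
  RelMap
    | Rel.lt => fun x => x 0 < x 1
    | Rel.edge => fun x => G.Adj (x 0) (x 1)

/-- `(n, <, R) ⊨ ψ`, where `R` is the adjacency relation of `G`. -/
def Models {n : ℕ} (G : SimpleGraph (Fin n)) (ψ : language.Sentence) : Prop :=
  @FirstOrder.Language.Sentence.Realize language (Fin n) (model G) ψ

/-- The pairs `(i, j)` with `i < j < n`. -/
def pairs (n : ℕ) : Finset (Fin n × Fin n) :=
  Finset.univ.filter fun e => e.1 < e.2

/-- The distance `j - i` of a pair `(i, j)`; used only when `i < j`. -/
def gap {n : ℕ} (e : Fin n × Fin n) : ℕ := (e.2 : ℕ) - (e.1 : ℕ)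

open Classical in
/-- The probability of the graph `G` on `{0, …, n-1}`: the product of `p (j - i)` over the edges
`i < j` of `G`, times the product of `1 - p (j - i)` over the non-edges `i < j`. -/
noncomputable def weight (p : ℕ → unitInterval) {n : ℕ} (G : SimpleGraph (Fin n)) : ℝ :=
  (∏ e ∈ (pairs n).filter (fun e => G.Adj e.1 e.2), (p (gap e) : ℝ)) *
    ∏ e ∈ (pairs n).filter (fun e => ¬ G.Adj e.1 e.2), (1 - (p (gap e) : ℝ))

theorem weight_nonneg (p : ℕ → unitInterval) {n : ℕ} (G : SimpleGraph (Fin n)) :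
    0 ≤ weight p G :=
  mul_nonneg (Finset.prod_nonneg fun _ _ => (p _).2.1)
    (Finset.prod_nonneg fun _ _ => sub_nonneg.2 (p _).2.2)

open Classical in
theorem sum_weight (p : ℕ → unitInterval) (n : ℕ) :
    ∑ G : SimpleGraph (Fin n), weight p G = 1 := by
  have h := Finset.prod_add (fun e => (p (gap e) : ℝ)) (fun e => 1 - (p (gap e) : ℝ)) (pairs n)
  simp only [add_sub_cancel, Finset.prod_const_one] at h
  rw [h]
  refine Finset.sum_bij' (fun G _ => (pairs n).filter (fun e => G.Adj e.1 e.2))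
    (fun t _ => SimpleGraph.fromRel (fun a b => (a, b) ∈ t)) ?_ ?_ ?_ ?_ ?_
  · intro G _
    simp
  · intro t _
    simp
  · intro G _
    ext a b
    simp only [SimpleGraph.fromRel_adj, Finset.mem_filter, pairs, Finset.mem_univ, true_and]
    constructor
    · rintro ⟨_, h | h⟩
      · exact h.2
      · exact h.2.symm
    · intro hab
      refine ⟨hab.ne, ?_⟩
      rcases lt_or_gt_of_ne hab.ne with h | h
      · exact Or.inl ⟨h, hab⟩
      · exact Or.inr ⟨h, hab.symm⟩
  · intro t ht
    rw [Finset.mem_powerset] at ht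
    have hlt : ∀ e ∈ t, e.1 < e.2 := fun e he => (Finset.mem_filter.1 (ht he)).2
    ext ⟨a, b⟩
    simp only [Finset.mem_filter, SimpleGraph.fromRel_adj]
    constructor
    · rintro ⟨hp, _, h | h⟩
      · exact h
      · have h1 := hlt _ h
        have h2 := (Finset.mem_filter.1 hp).2
        exact absurd h1 (lt_asymm h2)
    · intro h
      exact ⟨ht h, (hlt _ h).ne, Or.inl h⟩
  · intro G _
    unfold weight
    congr 2
    ext e
    simp only [Finset.mem_filter, Finset.mem_sdiff]
    tauto

open Classical in
/-- The distribution `μ_n` of the random graph `R` of `M_n = (n, <, R)`: each pair `i < j < n` is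
an edge with probability `p (j - i)`, independently for different pairs. -/
noncomputable def distribution (p : ℕ → unitInterval) (n : ℕ) : PMF (SimpleGraph (Fin n)) :=
  PMF.ofFintype (fun G => ENNReal.ofReal (weight p G)) (by
    rw [← ENNReal.ofReal_sum_of_nonneg fun G _ => weight_nonneg p G, sum_weight,
      ENNReal.ofReal_one])

/-- `Prob(M_n ⊨ ψ)`. -/
noncomputable def prob (p : ℕ → unitInterval) (n : ℕ) (ψ : language.Sentence) : ℝ :=
  ((distribution p n).toOuterMeasure {G | Models G ψ}).toReal

end OrderedRandomGraph

namespace OrderedRandomGraph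

open Filter Set MeasureTheory Topology

/-! Realize every $M_n$ inside one stationary random graph on `ℤ`, as the graph induced on `[0, n)`
(`prob_eq_measureReal`). A sentence is decided by the rank `d` Ehrenfeucht–Fraïssé type of that
interval for a suitable `d` (`exists_models_iff`), and there are finitely many such types, so it
suffices to compare the laws of the types of intervals of lengths `n` and `n + 1`.

Summability enters through Borel–Cantelli: almost surely all degrees are finite
(`ae_finite_setOf_adj`). In a locally finite graph, if two right half-lines have the same type, so
do the intervals obtained by cutting both at a common far point (`eventually_rankType_Ico_eq`); the
mirror statement holds for left half-lines. Hence, outside an event of small probability, the types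
of the half-lines `[i, ∞)` and `(-∞, j + n)` determine the type of `[i, j + n)`, for `i`, `j` in a
fixed finite set (`exists_intervalType_determined`).

The rule giving this type depends on the configuration, so one averages over starting points. For `k
< V` compare `[s k, s k + n)` with `[s k, s k + 1 + n)`: by stationarity each comparison has the
same mean, the difference sought. For a fixed configuration both families obey the same rule, so the
averages differ by at most the discrepancy between the counts of (left type, right type) pairs.
Mixing (`tendsto_measureReal_inter_shift`) decouples left types from right types as `n → ∞`, and
makes the differences of right-type indicators at distinct `k` nearly uncorrelated when `s` is
large. The discrepancy thus has second moment small compared with `V ^ 2`, and dividing by `V` gives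
the theorem. -/

/-! ### Ehrenfeucht–Fraïssé types of finite rank. -/

/-- Quantifier-free types of `m`-tuples: the order and adjacency relations between the entries. -/
abbrev QfType (m : ℕ) : Type := Fin m → Fin m → Prop × Prop

/-- Types of `m`-tuples of quantifier rank `k`. -/
def RankType : ℕ → ℕ → Type
  | 0, m => QfType m
  | k + 1, m => QfType m × Set (RankType k (m + 1))

instance RankType.instFinite : ∀ k m, Finite (RankType k m)
  | 0, m => inferInstanceAs (Finite (QfType m))
  | k + 1, m =>
    have := RankType.instFinite k (m + 1)
    inferInstanceAs (Finite (QfType m × Set (RankType k (m + 1))))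

/-- The quantifier-free type of a tuple of integers in the structure `(ℤ, <, E)`. -/
def qfType (E : ℤ → ℤ → Prop) {m : ℕ} (a : Fin m → ℤ) : QfType m :=
  fun i j => (a i < a j, E (a i) (a j))

/-- The rank `k` type of the tuple `a` in the structure `(I, <, E)`. -/
def rankType (E : ℤ → ℤ → Prop) (I : Set ℤ) : (k : ℕ) → {m : ℕ} → (Fin m → ℤ) → RankType k m
  | 0, _, a => qfType E a
  | k + 1, _, a => (qfType E a, {t | ∃ x ∈ I, rankType E I k (Fin.snoc a x) = t})

theorem qfType_eq_iff {E E' : ℤ → ℤ → Prop} {m : ℕ} {a a' : Fin m → ℤ} :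
    qfType E a = qfType E' a' ↔
      ∀ i j, (a i < a j ↔ a' i < a' j) ∧ (E (a i) (a j) ↔ E' (a' i) (a' j)) := by
  simp only [qfType, funext_iff, Prod.mk.injEq, eq_iff_iff]

theorem rankType_succ_eq_iff {E E' : ℤ → ℤ → Prop} {I I' : Set ℤ} {k m : ℕ} {a a' : Fin m → ℤ} :
    rankType E I (k + 1) a = rankType E' I' (k + 1) a' ↔ qfType E a = qfType E' a' ∧
      (∀ x ∈ I, ∃ y ∈ I', rankType E I k (Fin.snoc a x) = rankType E' I' k (Fin.snoc a' y)) ∧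
      ∀ y ∈ I', ∃ x ∈ I, rankType E I k (Fin.snoc a x) = rankType E' I' k (Fin.snoc a' y) := by
  refine Iff.trans (b := qfType E a = qfType E' a' ∧
    ({t | ∃ x ∈ I, rankType E I k (Fin.snoc a x : Fin (m + 1) → ℤ) = t} : Set _) =
      {t | ∃ x ∈ I', rankType E' I' k (Fin.snoc a' x : Fin (m + 1) → ℤ) = t}) Prod.mk_inj ?_
  rw [Set.Subset.antisymm_iff]
  refine and_congr_right fun _ => and_congr ?_ ?_
  · constructor
    · intro h x hx
      obtain ⟨y, hy, h⟩ := h ⟨x, hx, rfl⟩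
      exact ⟨y, hy, h.symm⟩
    · rintro h t ⟨x, hx, rfl⟩
      obtain ⟨y, hy, h⟩ := h x hx
      exact ⟨y, hy, h.symm⟩
  · constructor
    · intro h x hx
      exact h ⟨x, hx, rfl⟩
    · rintro h t ⟨x, hx, rfl⟩
      exact h x hx

theorem qfType_eq_of_rankType_eq {E E' : ℤ → ℤ → Prop} {I I' : Set ℤ} :
    ∀ {k m : ℕ} {a a' : Fin m → ℤ}, rankType E I k a = rankType E' I' k a' →
      qfType E a = qfType E' a'
  | 0, _, _, _, h => h
  | _ + 1, _, _, _, h => (rankType_succ_eq_iff.1 h).1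

theorem rankType_eq_of_succ {E E' : ℤ → ℤ → Prop} {I I' : Set ℤ} {k : ℕ} :
    ∀ {m : ℕ} {a a' : Fin m → ℤ}, rankType E I (k + 1) a = rankType E' I' (k + 1) a' →
      rankType E I k a = rankType E' I' k a' := by
  induction k with
  | zero => exact qfType_eq_of_rankType_eq
  | succ k ih =>
    intro m a a' h
    obtain ⟨h0, h1, h2⟩ := rankType_succ_eq_iff.1 h
    refine rankType_succ_eq_iff.2 ⟨h0, fun x hx => ?_, fun y hy => ?_⟩
    · obtain ⟨y, hy, hxy⟩ := h1 x hx
      exact ⟨y, hy, ih hxy⟩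
    · obtain ⟨x, hx, hxy⟩ := h2 y hy
      exact ⟨x, hx, ih hxy⟩

theorem rankType_comp_strictMono {E : ℤ → ℤ → Prop} {σ : ℤ → ℤ} (hσ : StrictMono σ) (I : Set ℤ)
    (k : ℕ) : ∀ {m : ℕ} (a : Fin m → ℤ),
      rankType (fun x y => E (σ x) (σ y)) I k a = rankType E (σ '' I) k (σ ∘ a) := by
  have hq : ∀ {m : ℕ} (a : Fin m → ℤ), qfType (fun x y => E (σ x) (σ y)) a = qfType E (σ ∘ a) :=
    fun a => qfType_eq_iff.2 fun i j => ⟨hσ.lt_iff_lt.symm, Iff.rfl⟩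
  induction k with
  | zero => exact hq
  | succ k ih =>
    intro m a
    refine rankType_succ_eq_iff.2 ⟨hq a, fun x hx => ⟨σ x, mem_image_of_mem σ hx, ?_⟩, ?_⟩
    · rw [ih, Fin.comp_snoc]
    · rintro _ ⟨x, hx, rfl⟩
      exact ⟨x, hx, by rw [ih, Fin.comp_snoc]⟩

/-- Reversing the order changes types, so only coincidences between two types can be transported.
This yields results on left half-lines by reflection. -/
theorem rankType_comp_strictAnti {E : ℤ → ℤ → Prop} {σ : ℤ → ℤ} (hσ : StrictAnti σ) (I I' : Set ℤ)
    (k : ℕ) : ∀ {m : ℕ} (a a' : Fin m → ℤ), rankType E (σ '' I) k (σ ∘ a) =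
      rankType E (σ '' I') k (σ ∘ a') →
      rankType (fun x y => E (σ x) (σ y)) I k a = rankType (fun x y => E (σ x) (σ y)) I' k a' := by
  have hq : ∀ {m : ℕ} (a a' : Fin m → ℤ), qfType E (σ ∘ a) = qfType E (σ ∘ a') →
      qfType (fun x y => E (σ x) (σ y)) a = qfType (fun x y => E (σ x) (σ y)) a' := by
    intro m a a' h
    rw [qfType_eq_iff] at h ⊢
    refine fun i j => ⟨?_, (h i j).2⟩
    exact hσ.lt_iff_gt.symm.trans ((h j i).1.trans hσ.lt_iff_gt)
  induction k with
  | zero => exact hq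
  | succ k ih =>
    intro m a a' h
    obtain ⟨h0, h1, h2⟩ := rankType_succ_eq_iff.1 h
    refine rankType_succ_eq_iff.2 ⟨hq _ _ h0, fun x hx => ?_, fun x hx => ?_⟩
    · obtain ⟨_, ⟨y, hy, rfl⟩, h⟩ := h1 _ (mem_image_of_mem σ hx)
      exact ⟨y, hy, ih _ _ (by simpa only [Fin.comp_snoc] using h)⟩
    · obtain ⟨_, ⟨y, hy, rfl⟩, h⟩ := h2 _ (mem_image_of_mem σ hx)
      exact ⟨y, hy, ih _ _ (by simpa only [Fin.comp_snoc] using h)⟩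

/-! ### The back-and-forth game on long intervals. -/

/-- Every answer to a move below `w` in the back-and-forth game between `[c, ∞)` and `[c', ∞)` can
be found below `w'`. -/
def AnswersBelow (E : ℤ → ℤ → Prop) (d : ℕ) (w w' c c' : ℤ) : Prop :=
  ∀ p ∈ Iic d, ∀ k ∈ Iic d, ∀ u ∈ Set.pi univ fun _ : Fin p => Icc c w,
    ∀ u' ∈ Set.pi univ fun _ : Fin p => Icc c' w, ∀ x ∈ Icc c w,
      rankType E (Ici c) (k + 1) u = rankType E (Ici c') (k + 1) u' →
        ∃ y ∈ Icc c' w', rankType E (Ici c) k (Fin.snoc u x : Fin (p + 1) → ℤ) =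
          rankType E (Ici c') k (Fin.snoc u' y : Fin (p + 1) → ℤ)

/-- Moves confined to a bounded window and ranks at most `d` leave finitely many positions. Each has
an answer somewhere on the half-line, so one bound covers all the chosen answers. -/
theorem eventually_answersBelow (E : ℤ → ℤ → Prop) (d : ℕ) (w c c' : ℤ) :
    ∀ᶠ w' in atTop, AnswersBelow E d w w' c c' := by
  unfold AnswersBelow
  refine (eventually_all_finite (finite_Iic d)).2 fun p _ =>
    (eventually_all_finite (finite_Iic d)).2 fun k _ =>
    (eventually_all_finite (Set.Finite.pi fun _ => finite_Icc _ _)).2 fun u _ =>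
    (eventually_all_finite (Set.Finite.pi fun _ => finite_Icc _ _)).2 fun u' _ =>
    (eventually_all_finite (finite_Icc _ _)).2 fun x hx => ?_
  by_cases h : rankType E (Ici c) (k + 1) u = rankType E (Ici c') (k + 1) u'
  · obtain ⟨y, hy, hxy⟩ := (rankType_succ_eq_iff.1 h).2.1 x hx.1
    filter_upwards [eventually_ge_atTop y] with w' hw' _
    exact ⟨y, ⟨hy, hw'⟩, hxy⟩
  · exact Eventually.of_forall fun _ h' => absurd h' h

theorem eventually_no_edge {E : ℤ → ℤ → Prop} (hE : ∀ a, {b | E a b}.Finite) (c w : ℤ) :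
    ∀ᶠ w' in atTop, ∀ a ∈ Icc c w, ∀ b, w' < b → ¬ E a b := by
  refine (eventually_all_finite (finite_Icc _ _)).2 fun a _ => ?_
  obtain ⟨M, hM⟩ := (hE a).bddAbove
  filter_upwards [eventually_ge_atTop M] with w' hw' b hb h
  exact absurd (hM h) (by simp only [not_le]; omega)

/-- The two conditions under which the game can be split between the thresholds `w i`. -/
structure IsThreshold (E : ℤ → ℤ → Prop) (d : ℕ) (w : ℕ → ℤ) (c c' : ℤ) : Prop where
  le : c' ≤ w 0
  answers : ∀ i, AnswersBelow E d (w i) (w (i + 1)) c c'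
  no_edge : ∀ i, ∀ a ∈ Icc c (w i), ∀ b, w (i + 1) < b → ¬ E a b

theorem exists_isThreshold {E : ℤ → ℤ → Prop} (hE : ∀ a, {b | E a b}.Finite) (d : ℕ) (c c' : ℤ) :
    ∃ w : ℕ → ℤ, StrictMono w ∧ IsThreshold E d w c c' ∧ IsThreshold E d w c' c := by
  have h : ∀ w : ℤ, ∃ w', w < w' ∧ (AnswersBelow E d w w' c c' ∧ AnswersBelow E d w w' c' c) ∧
      (∀ a ∈ Icc c w, ∀ b, w' < b → ¬ E a b) ∧ ∀ a ∈ Icc c' w, ∀ b, w' < b → ¬ E a b := fun w =>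
    ((eventually_gt_atTop w).and (((eventually_answersBelow E d w c c').and
      (eventually_answersBelow E d w c' c)).and ((eventually_no_edge hE c w).and
        (eventually_no_edge hE c' w)))).exists
  choose g hg using h
  -- Starting from the maximum puts both left endpoints below every threshold, as the two symmetric
  -- conditions require.
  refine ⟨fun i => g^[i] (max c c'), strictMono_nat_of_lt_succ fun i => ?_,
    ⟨le_max_right _ _, fun i => ?_, fun i => ?_⟩, ⟨le_max_left _ _, fun i => ?_, fun i => ?_⟩⟩ <;>
  simp only [Function.iterate_succ_apply']
  · exact (hg _).1
  · exact (hg _).2.1.1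
  · exact (hg _).2.2.1
  · exact (hg _).2.1.2
  · exact (hg _).2.2.2

/-- The back-and-forth game between `[c, m)` and `[c', m)`: entries up to `w i` follow the game
between the half-lines (the tuples `u` and `u'`), entries beyond `w (i + (2 ^ (k + 1) - 1))` are
equal, and the gap between the two kinds leaves room for the `k` remaining rounds. -/
theorem rankType_Ico_eq_of_threshold {E : ℤ → ℤ → Prop} (hs : ∀ {x y}, E x y → E y x) {d : ℕ}
    {w : ℕ → ℤ} (hw : StrictMono w) {m : ℤ} :
    ∀ (k p r i : ℕ) (c c' : ℤ) (u u' : Fin p → ℤ) (a a' : Fin r → ℤ),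
      IsThreshold E d w c c' → IsThreshold E d w c' c → p + k ≤ d →
      (∀ s, u s ∈ Icc c (w i)) → (∀ s, u' s ∈ Icc c' (w i)) →
      rankType E (Ici c) k u = rankType E (Ici c') k u' →
      (∀ t, (∃ s, a t = u s ∧ a' t = u' s) ∨ a t = a' t ∧ w (i + (2 ^ (k + 1) - 1)) < a t) →
      w (i + (2 ^ (k + 1) - 1)) < m →
      rankType E (Ico c m) k a = rankType E (Ico c' m) k a' := by
  have hq : ∀ (k p r i : ℕ) (c c' : ℤ) (u u' : Fin p → ℤ) (a a' : Fin r → ℤ),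
      IsThreshold E d w c c' → IsThreshold E d w c' c →
      (∀ s, u s ∈ Icc c (w i)) → (∀ s, u' s ∈ Icc c' (w i)) →
      rankType E (Ici c) k u = rankType E (Ici c') k u' →
      (∀ t, (∃ s, a t = u s ∧ a' t = u' s) ∨ a t = a' t ∧ w (i + (2 ^ (k + 1) - 1)) < a t) →
      qfType E a = qfType E a' := by
    intro k p r i c c' u u' a a' ht ht' hu hu' h ha
    have h0 := qfType_eq_iff.1 (qfType_eq_of_rankType_eq h)
    have hi : w (i + 1) ≤ w (i + (2 ^ (k + 1) - 1)) := hw.monotone (by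
      have := Nat.one_le_two_pow (n := k); rw [pow_succ]; omega)
    have hi' : w i < w (i + 1) := hw (Nat.lt_succ_self i)
    refine qfType_eq_iff.2 fun s t => ?_
    rcases ha s with ⟨s', hs1, hs2⟩ | ⟨hs1, hs2⟩ <;> rcases ha t with ⟨t', ht1, ht2⟩ | ⟨ht1, ht2⟩
    · rw [hs1, hs2, ht1, ht2]
      exact h0 s' t'
    -- One entry is at most `w i` and the other exceeds `w (i + 1)`: their order is forced and they
    -- are not adjacent, on either side.
    · have e1 := hu s'
      have e2 := hu' s'
      rw [hs1, hs2, ← ht1]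
      refine ⟨iff_of_true ?_ ?_, iff_of_false (ht.no_edge i _ e1 _ ?_) (ht'.no_edge i _ e2 _ ?_)⟩
      all_goals simp only [mem_Icc] at *; omega
    · have e1 := hu t'
      have e2 := hu' t'
      rw [ht1, ht2, ← hs1]
      refine ⟨iff_of_false ?_ ?_, iff_of_false (fun h => ht.no_edge i _ e1 _ ?_ (hs h))
        (fun h => ht'.no_edge i _ e2 _ ?_ (hs h))⟩
      all_goals simp only [mem_Icc] at *; omega
    · rw [← hs1, ← ht1]
      exact ⟨Iff.rfl, Iff.rfl⟩
  intro k
  induction k with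
  | zero =>
    intro p r i c c' u u' a a' ht ht' _ hu hu' h ha _
    exact hq 0 p r i c c' u u' a a' ht ht' hu hu' h ha
  | succ k ih =>
    have step : ∀ (p r i : ℕ) (c c' : ℤ) (u u' : Fin p → ℤ) (a a' : Fin r → ℤ),
        IsThreshold E d w c c' → IsThreshold E d w c' c → p + (k + 1) ≤ d →
        (∀ s, u s ∈ Icc c (w i)) → (∀ s, u' s ∈ Icc c' (w i)) →
        rankType E (Ici c) (k + 1) u = rankType E (Ici c') (k + 1) u' →
        (∀ t, (∃ s, a t = u s ∧ a' t = u' s) ∨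
          a t = a' t ∧ w (i + (2 ^ (k + 1 + 1) - 1)) < a t) →
        w (i + (2 ^ (k + 1 + 1) - 1)) < m → ∀ x ∈ Ico c m, ∃ y ∈ Ico c' m,
          rankType E (Ico c m) k (Fin.snoc a x : Fin (r + 1) → ℤ) =
            rankType E (Ico c' m) k (Fin.snoc a' y : Fin (r + 1) → ℤ) := by
      intro p r i c c' u u' a a' ht ht' hpk hu hu' h ha hm x hx
      -- `g` is the number of threshold steps needed for the `k` later rounds; the present buffer is
      -- `g + 1 + g`. A move up to `w (i + g)` is answered up to `w (i + g + 1)`, which leaves `g`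
      -- steps above; a move beyond `w (i + g)` is copied, which leaves `g` steps below it.
      set g := 2 ^ (k + 1) - 1 with hg
      have hg2 : 2 ^ (k + 1 + 1) - 1 = g + 1 + g := by
        have := Nat.one_le_two_pow (n := k + 1); rw [pow_succ]; omega
      rw [hg2] at ha hm
      have hle : w (i + 1 + g) ≤ w (i + (g + 1 + g)) := hw.monotone (by omega)
      have hle' : w (i + g) ≤ w (i + (g + 1 + g)) := hw.monotone (by omega)
      have hi1 : w i ≤ w (i + g) := hw.monotone (by omega)
      have hi2 : w (i + g) ≤ w (i + g + 1) := hw.monotone (by omega)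
      have hi3 : w (i + g + 1) ≤ w (i + (g + 1 + g)) := hw.monotone (by omega)
      rcases le_or_gt x (w (i + g)) with hxw | hxw
      · obtain ⟨y, hy, hxy⟩ := ht.answers (i + g) p (by simp only [mem_Iic]; omega) k
          (by simp only [mem_Iic]; omega) u
          (fun s _ => ⟨(hu s).1, (hu s).2.trans hi1⟩) u'
          (fun s _ => ⟨(hu' s).1, (hu' s).2.trans hi1⟩) x ⟨hx.1, hxw⟩ h
        refine ⟨y, ⟨hy.1, by have := hy.2; omega⟩,
          ih (p + 1) (r + 1) (i + g + 1) c c' (Fin.snoc u x) (Fin.snoc u' y) _ _ ht ht'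
          (by omega) ?_ ?_ hxy ?_ ?_⟩
        · refine Fin.lastCases ?_ fun s => ?_
          · rw [Fin.snoc_last]; exact ⟨hx.1, hxw.trans hi2⟩
          · rw [Fin.snoc_castSucc]; exact ⟨(hu s).1, (hu s).2.trans (hi1.trans hi2)⟩
        · refine Fin.lastCases ?_ fun s => ?_
          · rw [Fin.snoc_last]; exact hy
          · rw [Fin.snoc_castSucc]; exact ⟨(hu' s).1, (hu' s).2.trans (hi1.trans hi2)⟩
        · refine Fin.lastCases ?_ fun t => ?_
          · exact Or.inl ⟨Fin.last p, by simp only [Fin.snoc_last], by simp only [Fin.snoc_last]⟩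
          · simp only [Fin.snoc_castSucc]
            rcases ha t with ⟨s, h1, h2⟩ | h1
            · exact Or.inl ⟨s.castSucc, by simp only [Fin.snoc_castSucc, h1],
                by simp only [Fin.snoc_castSucc, h2]⟩
            · exact Or.inr (by rw [show i + g + 1 + g = i + (g + 1 + g) by ring]; exact h1)
        · rw [show i + g + 1 + g = i + (g + 1 + g) by ring]; exact hm
      · have hc' : c' ≤ x := (ht.le.trans (hw.monotone (Nat.zero_le _))).trans hxw.le
        refine ⟨x, ⟨hc', hx.2⟩, ih p (r + 1) i c c' u u' _ _ ht ht' (by omega) hu hu' ?_ ?_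
          (hxw.trans hx.2)⟩
        -- A copied move is not played on the half-lines, whose game just loses one round.
        · exact rankType_eq_of_succ h
        · refine Fin.lastCases ?_ fun t => ?_
          · simp only [Fin.snoc_last]; exact Or.inr ⟨trivial, hxw⟩
          · simp only [Fin.snoc_castSucc]
            exact (ha t).imp id fun h => ⟨h.1, hle'.trans_lt h.2⟩
    intro p r i c c' u u' a a' ht ht' hpk hu hu' h ha hm
    refine rankType_succ_eq_iff.2 ⟨hq _ p r i c c' u u' a a' ht ht' hu hu' h ha,
      step p r i c c' u u' a a' ht ht' hpk hu hu' h ha hm, fun y hy => ?_⟩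
    obtain ⟨x, hx, hxy⟩ := step p r i c' c u' u a' a ht' ht hpk hu' hu h.symm (fun t => by
      rcases ha t with ⟨s, h1, h2⟩ | ⟨h1, h2⟩
      · exact Or.inl ⟨s, h2, h1⟩
      · exact Or.inr ⟨h1.symm, h1 ▸ h2⟩) hm y hy
    exact ⟨x, hx, hxy.symm⟩

/-- If `[c, ∞)` and `[c', ∞)` have the same type, then so do `[c, m)` and `[c', m)` for large `m`. -/
theorem eventually_rankType_Ico_eq {E : ℤ → ℤ → Prop} (hs : ∀ {x y}, E x y → E y x)
    (hE : ∀ a, {b | E a b}.Finite) {d : ℕ} {c c' : ℤ}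
    (h : rankType E (Ici c) d ![] = rankType E (Ici c') d ![]) :
    ∀ᶠ m in atTop, rankType E (Ico c m) d ![] = rankType E (Ico c' m) d ![] := by
  obtain ⟨w, hw, h1, h2⟩ := exists_isThreshold hE d c c'
  filter_upwards [eventually_gt_atTop (w (0 + (2 ^ (d + 1) - 1)))] with m hm
  exact rankType_Ico_eq_of_threshold hs hw d 0 0 0 c c' _ _ _ _ h1 h2 (by omega)
    (fun s => s.elim0) (fun s => s.elim0) h (fun s => s.elim0) hm

/-- If `(-∞, c)` and `(-∞, c')` have the same type, then so do `[m, c)` and `[m, c')` for small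
`m`. -/
theorem eventually_atBot_rankType_Ico_eq {E : ℤ → ℤ → Prop} (hs : ∀ {x y}, E x y → E y x)
    (hE : ∀ a, {b | E a b}.Finite) {d : ℕ} {c c' : ℤ}
    (h : rankType E (Iio c) d ![] = rankType E (Iio c') d ![]) :
    ∀ᶠ m in atBot, rankType E (Ico m c) d ![] = rankType E (Ico m c') d ![] := by
  -- The offset `-1` makes the reflection match half-open intervals: it exchanges `[-c, ∞)` with
  -- `(-∞, c)`. The reflected graph is again symmetric and locally finite.
  set σ : ℤ → ℤ := fun x => -1 - x with hσ
  have hanti : StrictAnti σ := fun x y h => by simp only [hσ]; omega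
  have hσσ : ∀ x, σ (σ x) = x := fun x => by simp only [hσ]; omega
  have himage : ∀ I, σ '' I = σ ⁻¹' I := fun I =>
    congrFun (image_eq_preimage_of_inverse hσσ hσσ) I
  have hIio : ∀ c, σ '' Ici (-c) = Iio c := fun c => by
    rw [himage]; ext x; simp only [hσ, mem_preimage, mem_Ici, mem_Iio]; omega
  have hIco : ∀ m c, σ '' Ico m c = Ico (-c) (-m) := fun m c => by
    rw [himage]; ext x; simp only [hσ, mem_preimage, mem_Ico]; omega
  have h' := eventually_rankType_Ico_eq (E := fun x y => E (σ x) (σ y)) (d := d) (c := -c)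
    (c' := -c') (fun h => hs h)
    (fun a => ((hE (σ a)).preimage (f := σ) hanti.injective.injOn))
    (rankType_comp_strictAnti hanti _ _ _ _ _ (by
      rw [hIio, hIio]
      convert h using 2))
  filter_upwards [tendsto_neg_atBot_atTop.eventually h'] with m hm
  have := rankType_comp_strictAnti (E := fun x y => E (σ x) (σ y)) hanti (Ico m c) (Ico m c') d
    ![] ![] (by
      rw [hIco, hIco]
      convert hm using 2)
  simpa only [hσσ] using this

/-! ### From types to first-order sentences. -/

theorem term_eq_var {m : ℕ} (t : language.Term (Empty ⊕ Fin m)) :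
    ∃ i, t = FirstOrder.Language.Term.var (Sum.inr i) := by
  rcases t with (e | i) | ⟨f, _⟩
  · exact e.elim
  · exact ⟨i, rfl⟩
  · exact Empty.elim f

/-- Truth of a formula only depends on the type of the tuple, for a suitable rank. -/
theorem exists_realize_iff_of_rankType_eq {m : ℕ} (φ : language.BoundedFormula Empty m) :
    ∃ d, ∀ k ≥ d, ∀ (n n' : ℕ) (G : SimpleGraph (Fin n)) (G' : SimpleGraph (Fin n'))
      (E E' : ℤ → ℤ → Prop), (∀ x y : Fin n, G.Adj x y ↔ E (x : ℕ) (y : ℕ)) →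
      (∀ x y : Fin n', G'.Adj x y ↔ E' (x : ℕ) (y : ℕ)) → ∀ (a : Fin m → Fin n)
      (a' : Fin m → Fin n'),
      rankType E (Ico 0 n) k (fun i => ((a i : ℕ) : ℤ)) =
        rankType E' (Ico 0 n') k (fun i => ((a' i : ℕ) : ℤ)) →
      ((@FirstOrder.Language.BoundedFormula.Realize language (Fin n) (model G) Empty m φ
        Empty.elim a) ↔ @FirstOrder.Language.BoundedFormula.Realize language (Fin n') (model G')
        Empty m φ Empty.elim a') := by
  induction φ with
  | falsum => exact ⟨0, fun _ _ _ _ _ _ _ _ _ _ _ _ _ => Iff.rfl⟩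
  | equal t₁ t₂ =>
    obtain ⟨i, rfl⟩ := term_eq_var t₁
    obtain ⟨j, rfl⟩ := term_eq_var t₂
    refine ⟨0, fun k hk n n' G G' E E' hG hG' a a' h => ?_⟩
    have hq := qfType_eq_iff.1 (qfType_eq_of_rankType_eq h)
    -- Equality is not recorded in a quantifier-free type; it is the failure of both strict
    -- inequalities.
    have h1 := (hq i j).1
    have h2 := (hq j i).1
    change a i = a j ↔ a' i = a' j
    rw [Fin.ext_iff, Fin.ext_iff]
    omega
  | rel R ts =>
    refine ⟨0, fun k hk n n' G G' E E' hG hG' a a' h => ?_⟩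
    have hq := qfType_eq_iff.1 (qfType_eq_of_rankType_eq h)
    choose f hf using fun i => term_eq_var (ts i)
    obtain rfl : ts = fun i => FirstOrder.Language.Term.var (Sum.inr (f i)) := funext hf
    cases R with
    | lt =>
      have h1 := (hq (f 0) (f 1)).1
      change a (f 0) < a (f 1) ↔ a' (f 0) < a' (f 1)
      rw [Fin.lt_def, Fin.lt_def]
      omega
    | edge =>
      change G.Adj (a (f 0)) (a (f 1)) ↔ G'.Adj (a' (f 0)) (a' (f 1))
      rw [hG, hG']
      exact (hq (f 0) (f 1)).2
  | imp φ₁ φ₂ ih₁ ih₂ =>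
    obtain ⟨d₁, h₁⟩ := ih₁
    obtain ⟨d₂, h₂⟩ := ih₂
    refine ⟨max d₁ d₂, fun k hk n n' G G' E E' hG hG' a a' h => ?_⟩
    exact imp_congr (h₁ k (le_of_max_le_left hk) n n' G G' E E' hG hG' a a' h)
      (h₂ k (le_of_max_le_right hk) n n' G G' E E' hG hG' a a' h)
  | all φ ih =>
    obtain ⟨d, ih⟩ := ih
    refine ⟨d + 1, fun k hk n n' G G' E E' hG hG' a a' h => ?_⟩
    obtain ⟨k, rfl⟩ : ∃ j, k = j + 1 := ⟨k - 1, by omega⟩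
    obtain ⟨-, h1, h2⟩ := rankType_succ_eq_iff.1 h
    have hsnoc : ∀ {l N : ℕ} (b : Fin l → Fin N) (x : Fin N),
        (Fin.snoc (fun i => ((b i : ℕ) : ℤ)) ((x : ℕ) : ℤ) : Fin (l + 1) → ℤ) =
          fun i => (((Fin.snoc b x : Fin (l + 1) → Fin N) i : ℕ) : ℤ) := fun {l N} b x =>
      (Fin.comp_snoc (fun y : Fin N => ((y : ℕ) : ℤ)) b x).symm
    have hmem : ∀ {N : ℕ} {x : ℤ}, x ∈ Ico 0 (N : ℤ) → ∃ y : Fin N, ((y : ℕ) : ℤ) = x :=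
      fun {N} {x} hx => ⟨⟨x.toNat, by have := hx.1; have := hx.2; omega⟩, by
        have := hx.1; simp only; omega⟩
    constructor
    · intro H y
      obtain ⟨x, hx, hxy⟩ := h2 (y : ℕ) ⟨by omega, by omega⟩
      obtain ⟨x, rfl⟩ := hmem hx
      rw [hsnoc, hsnoc] at hxy
      exact (ih k (by omega) n n' G G' E E' hG hG' _ _ hxy).1 (H x)
    · intro H x
      obtain ⟨y, hy, hxy⟩ := h1 (x : ℕ) ⟨by omega, by omega⟩
      obtain ⟨y, rfl⟩ := hmem hy
      rw [hsnoc, hsnoc] at hxy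
      exact (ih k (by omega) n n' G G' E E' hG hG' _ _ hxy).2 (H y)

/-! ### The stationary random graph on `ℤ`: invariance and mixing. -/

/-- Setwise convergence of measures dominated by a fixed finite measure can be checked on a
generating π-system. -/
theorem tendsto_measureReal_of_isPiSystem {Ω : Type*} [m : MeasurableSpace Ω] {ν : ℕ → Measure Ω}
    {ν' μ : Measure Ω} [IsFiniteMeasure μ] (hν : ∀ n, ν n ≤ μ) (hν' : ν' ≤ μ) {C : Set (Set Ω)}
    (hgen : m = MeasurableSpace.generateFrom C) (hpi : IsPiSystem C)
    (huniv : Tendsto (fun n => (ν n).real univ) atTop (𝓝 (ν'.real univ)))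
    (hC : ∀ t ∈ C, Tendsto (fun n => (ν n).real t) atTop (𝓝 (ν'.real t))) {t : Set Ω}
    (ht : MeasurableSet t) : Tendsto (fun n => (ν n).real t) atTop (𝓝 (ν'.real t)) := by
  have hfin : ∀ n, IsFiniteMeasure (ν n) := fun n => isFiniteMeasure_of_le μ (hν n)
  have hfin' : IsFiniteMeasure ν' := isFiniteMeasure_of_le μ hν'
  have hsum : ∀ (ρ : Measure Ω) [IsFiniteMeasure ρ] (f : ℕ → Set Ω),
      Pairwise (Function.onFun Disjoint f) →
      (∀ i, MeasurableSet (f i)) → ρ.real (⋃ i, f i) = ∑' i, ρ.real (f i) := by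
    intro ρ _ f hd hm
    simp only [measureReal_def]
    rw [measure_iUnion hd hm, ENNReal.tsum_toReal_eq fun i => measure_ne_top _ _]
  induction t, ht using MeasurableSpace.induction_on_inter hgen hpi with
  | empty => simp only [measureReal_empty, tendsto_const_nhds]
  | basic t ht => exact hC t ht
  | compl t htm ih =>
    simp only [measureReal_compl htm]
    exact huniv.sub ih
  | iUnion f hd hm ih =>
    simp only [hsum _ f hd hm]
    -- The common dominating measure is what permits exchanging the limit with a countable disjoint
    -- union.
    refine tendsto_tsum_of_dominated_convergence (bound := fun i => μ.real (f i)) ?_ ih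
      (Eventually.of_forall fun n i => ?_)
    · refine ENNReal.summable_toReal ?_
      rw [← measure_iUnion hd hm]
      exact measure_ne_top _ _
    · rw [Real.norm_of_nonneg measureReal_nonneg]
      exact ENNReal.toReal_mono (measure_ne_top _ _) (hν n _)

/-- Configurations of edges on `ℤ`; only the values at pairs `(a, b)` with `a < b` are used. -/
abbrev EdgeSpace : Type := ℤ × ℤ → Bool

/-- The law of the stationary random graph on `ℤ`. -/
noncomputable def edgeMeasure (p : ℕ → unitInterval) : Measure EdgeSpace :=
  Measure.infinitePi fun e => ProbabilityTheory.bernoulliMeasure true false (p (e.2 - e.1).toNat)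

theorem bernoulliMeasure_singleton_true (q : unitInterval) :
    ProbabilityTheory.bernoulliMeasure true false q {true} = ENNReal.ofReal q := by
  rw [ProbabilityTheory.bernoulliMeasure_apply q .of_discrete]
  simpa using (ENNReal.ofReal_coe_nnreal (p := unitInterval.toNNReal q)).symm

theorem bernoulliMeasure_singleton_false (q : unitInterval) :
    ProbabilityTheory.bernoulliMeasure true false q {false} = ENNReal.ofReal (1 - q) := by
  rw [ProbabilityTheory.bernoulliMeasure_apply q .of_discrete]
  simpa using (ENNReal.ofReal_coe_nnreal (p := unitInterval.toNNReal (unitInterval.symm q))).symm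

instance edgeMeasure.instIsProbabilityMeasure (p : ℕ → unitInterval) :
    IsProbabilityMeasure (edgeMeasure p) := by
  unfold edgeMeasure; infer_instance

/-- Adjacency in the graph given by a configuration. -/
def edge (ω : EdgeSpace) (a b : ℤ) : Prop :=
  (a < b ∧ ω (a, b) = true) ∨ (b < a ∧ ω (b, a) = true)

theorem edge_symm {ω : EdgeSpace} {a b : ℤ} (h : edge ω a b) : edge ω b a := Or.symm h

/-- The translation of pairs. -/
def pairShift (s : ℤ) : ℤ × ℤ ≃ ℤ × ℤ := Equiv.addRight (s, s)

theorem pairShift_apply (s : ℤ) (e : ℤ × ℤ) : pairShift s e = (e.1 + s, e.2 + s) := rfl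

/-- The translation of configurations. -/
def shift (s : ℤ) (ω : EdgeSpace) : EdgeSpace := fun e => ω (pairShift s e)

theorem edge_shift (s : ℤ) (ω : EdgeSpace) (a b : ℤ) :
    edge (shift s ω) a b ↔ edge ω (a + s) (b + s) := by
  simp only [edge, shift, pairShift_apply, add_lt_add_iff_right]

theorem shift_preimage_pi (s : ℤ) (F : Finset (ℤ × ℤ)) (t : ℤ × ℤ → Set Bool) :
    shift s ⁻¹' (F : Set (ℤ × ℤ)).pi t =
      (F.map (pairShift s).toEmbedding : Set (ℤ × ℤ)).pi fun e => t ((pairShift s).symm e) := by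
  ext ω
  simp only [mem_preimage, Set.mem_pi, Finset.mem_coe, Finset.mem_map_equiv, shift]
  exact ⟨fun h e he => by simpa using h _ he,
    fun h e he => by simpa using h (pairShift s e) (by simpa)⟩

theorem measurable_shift (s : ℤ) : Measurable (shift s) :=
  measurable_pi_lambda _ fun _ => measurable_pi_apply _

/-- The bias at a pair depends only on the difference of its entries, so translation permutes
identically biased coordinates. -/
theorem measurePreserving_shift (p : ℕ → unitInterval) (s : ℤ) :
    MeasurePreserving (shift s) (edgeMeasure p) (edgeMeasure p) := by
  refine ⟨measurable_shift s, Measure.eq_infinitePi _ fun F t ht => ?_⟩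
  rw [Measure.map_apply (measurable_shift s) (.pi F.countable_toSet fun _ _ => ht _),
    shift_preimage_pi, edgeMeasure, Measure.infinitePi_pi _ fun _ _ => ht _, Finset.prod_map]
  refine Finset.prod_congr rfl fun e _ => ?_
  rw [Equiv.coe_toEmbedding, Equiv.symm_apply_apply, pairShift_apply, add_sub_add_right_eq_sub]

theorem measureReal_shift_preimage (p : ℕ → unitInterval) (s : ℤ) {A : Set EdgeSpace}
    (hA : MeasurableSet A) : (edgeMeasure p).real (shift s ⁻¹' A) = (edgeMeasure p).real A := by
  rw [measureReal_def, (measurePreserving_shift p s).measure_preimage hA.nullMeasurableSet,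
    measureReal_def]

/-- For large `n` the pairs of `F` and the translated pairs of `F'` are disjoint, and independence
is then exact. -/
theorem eventually_measureReal_inter_shift_pi (p : ℕ → unitInterval) (F F' : Finset (ℤ × ℤ))
    (t t' : ℤ × ℤ → Set Bool) : ∀ᶠ n : ℕ in atTop,
      (edgeMeasure p).real ((F : Set (ℤ × ℤ)).pi t ∩ shift n ⁻¹' (F' : Set (ℤ × ℤ)).pi t') =
        (edgeMeasure p).real ((F : Set (ℤ × ℤ)).pi t) *
          (edgeMeasure p).real ((F' : Set (ℤ × ℤ)).pi t') := by
  classical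
  have h : ∀ᶠ n : ℕ in atTop, ∀ e ∈ F, ∀ e' ∈ F', e ≠ pairShift n e' := by
    refine (eventually_all_finset _).2 fun e _ => (eventually_all_finset _).2 fun e' _ => ?_
    filter_upwards [eventually_gt_atTop (e.1 - e'.1).toNat] with n hn h
    rw [pairShift_apply] at h
    have := congrArg Prod.fst h
    simp only at this
    omega
  filter_upwards [h] with n hn
  rw [← measureReal_shift_preimage p n (.pi F'.countable_toSet fun _ _ => .of_discrete),
    shift_preimage_pi]
  set F'' := F'.map (pairShift n).toEmbedding with hF''
  have hd : Disjoint F F'' := by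
    rw [Finset.disjoint_left]
    intro e he he'
    obtain ⟨e', he'', rfl⟩ := Finset.mem_map.1 he'
    exact hn _ he _ he'' rfl
  set t'' := fun e => t' ((pairShift n).symm e)
  have hunion : (F : Set (ℤ × ℤ)).pi t ∩ (F'' : Set (ℤ × ℤ)).pi t'' =
      ((F ∪ F'' : Finset (ℤ × ℤ)) : Set (ℤ × ℤ)).pi fun e => if e ∈ F then t e else t'' e := by
    ext ω
    simp only [Set.mem_inter_iff, Set.mem_pi, Finset.mem_coe, Finset.mem_union]
    constructor
    · rintro ⟨h1, h2⟩ e he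
      split_ifs with h
      · exact h1 e h
      · exact h2 e (he.resolve_left h)
    · intro h
      refine ⟨fun e he => ?_, fun e he => ?_⟩
      · simpa only [he, if_true] using h e (Or.inl he)
      · simpa only [Finset.disjoint_right.1 hd he, if_false] using h e (Or.inr he)
  rw [hunion]
  simp only [measureReal_def, edgeMeasure]
  rw [Measure.infinitePi_pi _ fun _ _ => .of_discrete, Measure.infinitePi_pi _ fun _ _ => .of_discrete,
    Measure.infinitePi_pi _ fun _ _ => .of_discrete, Finset.prod_union hd, ENNReal.toReal_mul]
  congr 2
  · exact Finset.prod_congr rfl fun e he => by simp only [he, if_true]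
  · exact Finset.prod_congr rfl fun e he => by
      simp only [Finset.disjoint_right.1 hd he, if_false]

/-- The stationary random graph is mixing. -/
theorem tendsto_measureReal_inter_shift (p : ℕ → unitInterval) {A B : Set EdgeSpace}
    (hA : MeasurableSet A) (hB : MeasurableSet B) :
    Tendsto (fun n : ℕ => (edgeMeasure p).real (A ∩ shift n ⁻¹' B)) atTop
      (𝓝 ((edgeMeasure p).real A * (edgeMeasure p).real B)) := by
  set μ := edgeMeasure p with hμ
  have hpi := isPiSystem_squareCylinders (ι := ℤ × ℤ) (α := fun _ => Bool)
    (C := fun i => {s | MeasurableSet s}) (fun _ => MeasurableSpace.isPiSystem_measurableSet) (by simp)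
  have hgen := (generateFrom_squareCylinders (ι := ℤ × ℤ) (α := fun _ => Bool)).symm
  have hscale : ∀ S : Set EdgeSpace, ENNReal.ofReal (μ.real S) • μ ≤ μ := fun S => by
    refine Measure.le_iff.2 fun s _ => ?_
    rw [Measure.smul_apply, smul_eq_mul]
    exact mul_le_of_le_one_left zero_le (ENNReal.ofReal_le_one.2 measureReal_le_one)
  have hscale' : ∀ S T : Set EdgeSpace,
      (ENNReal.ofReal (μ.real S) • μ).real T = μ.real S * μ.real T := fun S T => by
    rw [measureReal_ennreal_smul_apply, ENNReal.toReal_ofReal measureReal_nonneg]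
  -- The class of pairs of sets is enlarged in two passes. Here the first set stays a cylinder and
  -- `B` becomes arbitrary, using images under `shift n` of `μ` restricted to the cylinder;
  -- invariance bounds them by `μ`.
  have key : ∀ (F : Finset (ℤ × ℤ)) (t : ℤ × ℤ → Set Bool), Tendsto (fun n : ℕ =>
      μ.real ((F : Set (ℤ × ℤ)).pi t ∩ shift n ⁻¹' B)) atTop
        (𝓝 (μ.real ((F : Set (ℤ × ℤ)).pi t) * μ.real B)) := by
    intro F t
    have hF : MeasurableSet ((F : Set (ℤ × ℤ)).pi t) := .pi F.countable_toSet fun _ _ => .of_discrete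
    have hval : ∀ (n : ℕ) {S : Set EdgeSpace}, MeasurableSet S →
        ((μ.restrict ((F : Set (ℤ × ℤ)).pi t)).map (shift n)).real S =
          μ.real ((F : Set (ℤ × ℤ)).pi t ∩ shift n ⁻¹' S) := fun n S hS => by
      rw [map_measureReal_apply (measurable_shift n) hS,
        measureReal_restrict_apply (measurable_shift n hS), inter_comm]
    have := tendsto_measureReal_of_isPiSystem (μ := μ)
      (ν := fun n : ℕ => (μ.restrict ((F : Set (ℤ × ℤ)).pi t)).map (shift n))
      (ν' := ENNReal.ofReal (μ.real ((F : Set (ℤ × ℤ)).pi t)) • μ) (fun n => ?_) (hscale _) hgen hpi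
      ?_ ?_ hB
    · simpa only [hval _ hB, hscale'] using this
    · refine (Measure.map_mono Measure.restrict_le_self (measurable_shift n)).trans ?_
      rw [(measurePreserving_shift p n).map_eq]
    · simp only [hval _ MeasurableSet.univ, hscale', preimage_univ, inter_univ, probReal_univ,
        mul_one, tendsto_const_nhds]
    · rintro _ ⟨F', t', -, rfl⟩
      have hF' : MeasurableSet ((F' : Set (ℤ × ℤ)).pi t') :=
        .pi F'.countable_toSet fun _ _ => .of_discrete
      simp only [hval _ hF', hscale']
      exact tendsto_const_nhds.congr' ((eventually_measureReal_inter_shift_pi p F F' t t').mono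
        fun _ h => h.symm)
  have hval : ∀ (n : ℕ) {S : Set EdgeSpace}, MeasurableSet S →
      (μ.restrict (shift n ⁻¹' B)).real S = μ.real (S ∩ shift n ⁻¹' B) := fun n S hS => by
    rw [measureReal_restrict_apply hS]
  -- Second pass: `B` is fixed and the first set varies, using restrictions of `μ` to the preimages
  -- of `B`.
  have := tendsto_measureReal_of_isPiSystem (μ := μ)
    (ν := fun n : ℕ => μ.restrict (shift n ⁻¹' B))
    (ν' := ENNReal.ofReal (μ.real B) • μ) (fun n => Measure.restrict_le_self) (hscale _) hgen hpi
    ?_ ?_ hA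
  · simpa only [hval _ hA, hscale', mul_comm] using this
  · simp only [hval _ MeasurableSet.univ, hscale', univ_inter, probReal_univ, mul_one]
    simp only [hμ, measureReal_shift_preimage p _ hB, tendsto_const_nhds]
  · rintro _ ⟨F, t, -, rfl⟩
    have hF : MeasurableSet ((F : Set (ℤ × ℤ)).pi t) := .pi F.countable_toSet fun _ _ => .of_discrete
    simpa only [hval _ hF, hscale', mul_comm] using key F t

theorem measure_edge_eq_true (p : ℕ → unitInterval) (e : ℤ × ℤ) :
    edgeMeasure p {ω | ω e = true} = ENNReal.ofReal (p (e.2 - e.1).toNat) := by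
  have : {ω : EdgeSpace | ω e = true} = (({e} : Finset (ℤ × ℤ)) : Set (ℤ × ℤ)).pi
      fun _ => {true} := by ext; simp
  rw [this, edgeMeasure, Measure.infinitePi_pi _ fun _ _ => .of_discrete, Finset.prod_singleton,
    bernoulliMeasure_singleton_true]

/-- Borel–Cantelli, applied to the neighbours on each side of `a`. The rest of the argument uses
summability only through this. -/
theorem ae_finite_setOf_adj (p : ℕ → unitInterval) (hp : Summable fun i => (p i : ℝ)) :
    ∀ᵐ ω ∂edgeMeasure p, ∀ a, {b | edge ω a b}.Finite := by
  refine ae_all_iff.2 fun a => ?_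
  have hsum : ∀ f : ℕ → ℤ × ℤ, (∀ k, ((f k).2 - (f k).1).toNat = k) →
      ∀ᵐ ω ∂edgeMeasure p, {k | ω ∈ {ω : EdgeSpace | ω (f k) = true}}.Finite := by
    intro f hf
    refine ae_finite_setOfPred_mem ?_
    simp only [measure_edge_eq_true, hf]
    rw [← ENNReal.ofReal_tsum_of_nonneg (fun i => (p i).2.1) hp]
    exact ENNReal.ofReal_ne_top
  filter_upwards [hsum (fun k => (a, a + k)) (fun k => by simp),
    hsum (fun k => (a - k, a)) (fun k => by simp)] with ω h1 h2
  refine ((h1.image fun k : ℕ => a + k).union (h2.image fun k : ℕ => a - k)).subset ?_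
  rintro b (⟨hb, h⟩ | ⟨hb, h⟩)
  · have : a + ((b - a).toNat : ℤ) = b := by omega
    exact Or.inl ⟨(b - a).toNat, by simpa only [mem_ofPred_eq, this] using h, this⟩
  · have : a - ((a - b).toNat : ℤ) = b := by omega
    exact Or.inr ⟨(a - b).toNat, by simpa only [mem_ofPred_eq, this] using h, this⟩

theorem measurable_edge (a b : ℤ) : Measurable fun ω => edge ω a b := by
  refine measurableSet_setOfPred.1 ?_
  have h : ∀ e : ℤ × ℤ, MeasurableSet {ω : EdgeSpace | ω e = true} := fun e =>
    measurableSet_eq_fun (measurable_pi_apply e) measurable_const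
  exact ((MeasurableSet.const _).inter (h _)).union ((MeasurableSet.const _).inter (h _))

/-- Quantifiers run over the countable set `ℤ` and types form finite sets, so only countable Boolean
operations occur. -/
theorem measurableSet_rankType_eq (I : Set ℤ) (k : ℕ) : ∀ {m : ℕ} (a : Fin m → ℤ)
    (t : RankType k m), MeasurableSet {ω | rankType (edge ω) I k a = t} := by
  have hq : ∀ {m : ℕ} (a : Fin m → ℤ) (q : QfType m), Measurable fun ω => qfType (edge ω) a = q := by
    intro m a q
    have : (fun ω => qfType (edge ω) a = q) = fun ω => ∀ i j,
        ((a i < a j) ↔ (q i j).1) ∧ (edge ω (a i) (a j) ↔ (q i j).2) := by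
      ext ω
      simp only [qfType, funext_iff, Prod.ext_iff, eq_iff_iff]
    rw [this]
    exact .forall fun i => .forall fun j => measurable_const.and
      ((measurable_edge _ _).iff measurable_const)
  induction k with
  | zero => exact fun a q => measurableSet_setOfPred.2 (hq a q)
  | succ k ih =>
    intro m a t
    have : {ω | rankType (edge ω) I (k + 1) a = t} = {ω | qfType (edge ω) a = t.1 ∧
        ∀ s : RankType k (m + 1), (∃ x ∈ I, rankType (edge ω) I k (Fin.snoc a x) = s) ↔ s ∈ t.2} := by
      ext ω
      refine (Prod.ext_iff (x := rankType (edge ω) I (k + 1) a) (y := t)).trans ?_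
      exact and_congr Iff.rfl Set.ext_iff
    rw [this]
    exact measurableSet_setOfPred.2 ((hq a t.1).and (.forall fun s => .iff (.exists fun x =>
      measurable_const.and (measurableSet_setOfPred.1 (ih _ s))) measurable_const))

/-! ### The finite models as intervals of the stationary graph. -/

/-- The graph induced on `{0, …, n - 1}` by a configuration. -/
def inducedGraph (n : ℕ) (ω : EdgeSpace) : SimpleGraph (Fin n) where
  Adj x y := edge ω (x : ℕ) (y : ℕ)
  symm := ⟨fun _ _ h => edge_symm h⟩
  loopless := ⟨fun x h => by simp [edge] at h⟩

theorem measure_inducedGraph_eq (p : ℕ → unitInterval) {n : ℕ} (G : SimpleGraph (Fin n)) :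
    MeasurableSet {ω | inducedGraph n ω = G} ∧
      edgeMeasure p {ω | inducedGraph n ω = G} = ENNReal.ofReal (weight p G) := by
  classical
  let f : Fin n × Fin n ↪ ℤ × ℤ := ⟨fun e => ((e.1 : ℕ), (e.2 : ℕ)), fun e e' h => by
    simp only [Prod.mk.injEq, Nat.cast_inj] at h
    exact Prod.ext (Fin.ext h.1) (Fin.ext h.2)⟩
  -- The side of a box prescribing `G`: at a pair of vertices it is the single Boolean value given
  -- by adjacency, and off the image of `f` the condition is vacuous.
  let t : ℤ × ℤ → Set Bool := fun e => {b | ∀ e', f e' = e → (b = true ↔ G.Adj e'.1 e'.2)}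
  have hbox : {ω | inducedGraph n ω = G} = (((pairs n).map f : Finset (ℤ × ℤ)) : Set _).pi t := by
    ext ω
    simp only [mem_ofPred_eq, Set.mem_pi, Finset.mem_coe, t]
    constructor
    · rintro rfl e he e' rfl
      obtain ⟨e'', he'', h⟩ := Finset.mem_map.1 he
      obtain rfl := f.injective h
      have hlt : e''.1 < e''.2 := (Finset.mem_filter.1 he'').2
      change _ ↔ edge ω _ _
      rw [Fin.lt_def] at hlt
      have h1 : ((e''.1 : ℕ) : ℤ) < (e''.2 : ℕ) := by omega
      simp only [edge, h1, h1.not_gt, true_and, false_and, or_false]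
      rfl
    · intro h
      have key : ∀ x y : Fin n, x < y → (edge ω (x : ℕ) (y : ℕ) ↔ G.Adj x y) := by
        intro x y hxy
        have h1 : ((x : ℕ) : ℤ) < (y : ℕ) := by rw [Fin.lt_def] at hxy; omega
        simp only [edge, h1, h1.not_gt, true_and, false_and, or_false]
        exact h (f (x, y)) (Finset.mem_map_of_mem f (by simpa [pairs] using hxy)) (x, y) rfl
      ext x y
      rcases lt_trichotomy x y with hxy | rfl | hxy
      · exact key x y hxy
      · exact iff_of_false (SimpleGraph.irrefl _) (SimpleGraph.irrefl _)
      · rw [SimpleGraph.adj_comm, G.adj_comm]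
        exact key y x hxy
  rw [hbox]
  refine ⟨.pi (Finset.countable_toSet _) fun _ _ => .of_discrete, ?_⟩
  rw [edgeMeasure, Measure.infinitePi_pi _ fun _ _ => .of_discrete, Finset.prod_map, weight,
    ENNReal.ofReal_mul (Finset.prod_nonneg fun _ _ => (p _).2.1),
    ENNReal.ofReal_prod_of_nonneg fun _ _ => (p _).2.1,
    ENNReal.ofReal_prod_of_nonneg fun _ _ => sub_nonneg.2 (p _).2.2,
    ← Finset.prod_filter_mul_prod_filter_not (pairs n) (fun e => G.Adj e.1 e.2)]
  have ht : ∀ e b, b ∈ t (f e) ↔ (b = true ↔ G.Adj e.1 e.2) := fun e b =>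
    ⟨fun h => h e rfl, fun h e' he' => by rwa [f.injective he']⟩
  have hgap : ∀ e ∈ pairs n, ((f e).2 - (f e).1).toNat = gap e := fun e _ => by
    change (((e.2 : ℕ) : ℤ) - ((e.1 : ℕ) : ℤ)).toNat = (e.2 : ℕ) - (e.1 : ℕ)
    omega
  congr 1
  · refine Finset.prod_congr rfl fun e he => ?_
    obtain ⟨he, hadj⟩ := Finset.mem_filter.1 he
    rw [hgap e he, ← bernoulliMeasure_singleton_true]
    congr 1
    ext b
    simp [ht, hadj]
  · refine Finset.prod_congr rfl fun e he => ?_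
    obtain ⟨he, hadj⟩ := Finset.mem_filter.1 he
    rw [hgap e he, ← bernoulliMeasure_singleton_false]
    congr 1
    ext b
    simp [ht, hadj]

theorem prob_eq_measureReal (p : ℕ → unitInterval) (n : ℕ) (ψ : language.Sentence) :
    prob p n ψ = (edgeMeasure p).real {ω | Models (inducedGraph n ω) ψ} := by
  classical
  have : {ω | Models (inducedGraph n ω) ψ} = ⋃ G ∈ Finset.univ.filter fun G => Models G ψ,
      {ω | inducedGraph n ω = G} := by
    ext ω; simp
  rw [prob, measureReal_def, this, measure_biUnion_finset]
  · rw [PMF.toOuterMeasure_apply_fintype, Finset.sum_filter]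
    simp only [(measure_inducedGraph_eq p _).2, Set.indicator, mem_ofPred_eq]
    rfl
  · intro G _ G' _ h
    exact Set.disjoint_left.2 fun ω h1 h2 => h (h1.symm.trans h2)
  · exact fun G _ => (measure_inducedGraph_eq p G).1

/-- The rank `d` type of the interval `I` of the graph given by `ω`. -/
def intervalType (d : ℕ) (I : Set ℤ) (ω : EdgeSpace) : RankType d 0 := rankType (edge ω) I d ![]

theorem measurableSet_intervalType (d : ℕ) (I : Set ℤ) (T : Set (RankType d 0)) :
    MeasurableSet {ω | intervalType d I ω ∈ T} := by
  have : {ω | intervalType d I ω ∈ T} = ⋃ t ∈ T, {ω | intervalType d I ω = t} := by ext; simp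
  rw [this]
  exact .biUnion T.to_countable fun t _ => measurableSet_rankType_eq I d ![] t

theorem measurableSet_intervalType_eq (d : ℕ) (I J : Set ℤ) :
    MeasurableSet {ω | intervalType d I ω = intervalType d J ω} := by
  have : {ω | intervalType d I ω = intervalType d J ω} =
      ⋃ t, ({ω | intervalType d I ω = t} ∩ {ω | intervalType d J ω = t}) := by
    ext ω
    simp only [mem_iUnion]
    exact ⟨fun h => ⟨_, h, rfl⟩, fun ⟨t, h, h'⟩ => Eq.trans h (Eq.symm h')⟩
  rw [this]
  exact .iUnion fun t => (measurableSet_rankType_eq I d ![] t).inter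
    (measurableSet_rankType_eq J d ![] t)

theorem intervalType_shift (d : ℕ) (I : Set ℤ) (s : ℤ) (ω : EdgeSpace) :
    intervalType d I (shift s ω) = intervalType d ((fun x => x + s) '' I) ω := by
  have h := rankType_comp_strictMono (E := edge ω) (σ := fun x => x + s)
    (fun x y h => by simpa using h) I d ![]
  have he : edge (shift s ω) = fun x y => edge ω (x + s) (y + s) := by
    ext x y; exact edge_shift s ω x y
  rw [intervalType, he, h, intervalType]
  congr 1
  exact Subsingleton.elim _ _

theorem exists_models_iff (ψ : language.Sentence) : ∃ (d : ℕ) (T : Set (RankType d 0)),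
    ∀ (n : ℕ) (ω : EdgeSpace),
      Models (inducedGraph n ω) ψ ↔ intervalType d (Ico 0 (n : ℤ)) ω ∈ T := by
  obtain ⟨d, hd⟩ := exists_realize_iff_of_rankType_eq ψ
  -- `T` collects the types of models of every size. Since rank `d` decides `ψ` across different
  -- sizes, having a type in `T` suffices for truth.
  refine ⟨d, {t | ∃ (n : ℕ) (ω : EdgeSpace), intervalType d (Ico 0 (n : ℤ)) ω = t ∧
    Models (inducedGraph n ω) ψ}, fun n ω => ⟨fun h => ⟨n, ω, rfl, h⟩, ?_⟩⟩
  rintro ⟨n', ω', h, h'⟩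
  have key := hd d le_rfl n' n (inducedGraph n' ω') (inducedGraph n ω) (edge ω') (edge ω)
    (fun _ _ => Iff.rfl) (fun _ _ => Iff.rfl) default default (by
      unfold intervalType at h
      convert h using 2)
  have he : ∀ N : ℕ, (default : Empty → Fin N) = Empty.elim := fun _ => Subsingleton.elim _ _
  unfold Models FirstOrder.Language.Sentence.Realize FirstOrder.Language.Formula.Realize at h' ⊢
  rw [he] at h' ⊢
  exact key.1 h'

theorem tendsto_measureReal_zero_of_ae_eventually_notMem {Ω : Type*} [MeasurableSpace Ω]
    {μ : Measure Ω} [IsFiniteMeasure μ] {A : ℕ → Set Ω} (hA : ∀ n, MeasurableSet (A n))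
    (h : ∀ᵐ ω ∂μ, ∀ᶠ n in atTop, ω ∉ A n) : Tendsto (fun n => μ.real (A n)) atTop (𝓝 0) := by
  have := tendsto_measure_of_ae_tendsto_indicator (μ := μ) atTop MeasurableSet.empty hA
    MeasurableSet.univ (measure_ne_top _ _) (Eventually.of_forall fun _ => subset_univ _)
    (h.mono fun ω hω => hω.mono fun n hn => iff_of_false hn (notMem_empty ω))
  rw [measure_empty] at this
  exact (ENNReal.tendsto_toReal ENNReal.zero_ne_top).comp this

theorem tendsto_measureReal_Ico_ne_of_Ici_eq (p : ℕ → unitInterval)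
    (hp : Summable fun i => (p i : ℝ)) (d : ℕ) (i i' j : ℤ) :
    Tendsto (fun n : ℕ => (edgeMeasure p).real ({ω | intervalType d (Ici i) ω =
      intervalType d (Ici i') ω} ∩ {ω | intervalType d (Ico i (j + n)) ω =
        intervalType d (Ico i' (j + n)) ω}ᶜ)) atTop (𝓝 0) := by
  refine tendsto_measureReal_zero_of_ae_eventually_notMem (fun n =>
    (measurableSet_intervalType_eq d _ _).inter (measurableSet_intervalType_eq d _ _).compl) ?_
  filter_upwards [ae_finite_setOf_adj p hp] with ω hω
  by_cases h : intervalType d (Ici i) ω = intervalType d (Ici i') ω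
  · have := eventually_rankType_Ico_eq edge_symm hω h
    filter_upwards [(tendsto_atTop_add_const_left atTop j tendsto_natCast_atTop_atTop).eventually
      this] with n hn hmem
    exact hmem.2 hn
  · exact Eventually.of_forall fun n hn => h hn.1

theorem tendsto_measureReal_Ico_ne_of_Iio_eq (p : ℕ → unitInterval)
    (hp : Summable fun i => (p i : ℝ)) (d : ℕ) (i j j' : ℤ) :
    Tendsto (fun n : ℕ => (edgeMeasure p).real ({ω | intervalType d (Iio (j + n)) ω =
      intervalType d (Iio (j' + n)) ω} ∩ {ω | intervalType d (Ico i (j + n)) ω =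
        intervalType d (Ico i (j' + n)) ω}ᶜ)) atTop (𝓝 0) := by
  -- Translating by `-n` fixes the right endpoints and sends the left one to `-∞`, where the almost
  -- sure statement applies. Translating back preserves the probability for each `n`, which is all
  -- that is needed.
  have h : Tendsto (fun n : ℕ => (edgeMeasure p).real ({ω | intervalType d (Iio j) ω =
      intervalType d (Iio j') ω} ∩ {ω | intervalType d (Ico (i - n) j) ω =
        intervalType d (Ico (i - n) j') ω}ᶜ)) atTop (𝓝 0) := by
    refine tendsto_measureReal_zero_of_ae_eventually_notMem (fun n =>
      (measurableSet_intervalType_eq d _ _).inter (measurableSet_intervalType_eq d _ _).compl) ?_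
    filter_upwards [ae_finite_setOf_adj p hp] with ω hω
    by_cases h : intervalType d (Iio j) ω = intervalType d (Iio j') ω
    · have := eventually_atBot_rankType_Ico_eq edge_symm hω h
      have hlim : Tendsto (fun n : ℕ => i - (n : ℤ)) atTop atBot := by
        simp only [sub_eq_add_neg]
        exact tendsto_atBot_add_const_left _ i
          (tendsto_neg_atTop_atBot.comp tendsto_natCast_atTop_atTop)
      filter_upwards [hlim.eventually this] with n hn hmem
      exact hmem.2 hn
    · exact Eventually.of_forall fun n hn => h hn.1
  refine h.congr fun n => ?_
  rw [← measureReal_shift_preimage p n ((measurableSet_intervalType_eq d _ _).inter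
    (measurableSet_intervalType_eq d _ _).compl)]
  congr 1
  ext ω
  simp only [mem_preimage, mem_inter_iff, mem_ofPred_eq, mem_compl_iff, intervalType_shift,
    image_add_const_Iio, image_add_const_Ico, sub_add_cancel]

/-! ### Correlations of half-line types. -/

/-- The expectation of `1_A (1_B - 1_B') (1_C - 1_C')`. -/
noncomputable def correlation {Ω : Type*} [MeasurableSpace Ω] (μ : Measure Ω)
    (A B B' C C' : Set Ω) : ℝ :=
  μ.real (A ∩ (B ∩ C)) - μ.real (A ∩ (B ∩ C')) - μ.real (A ∩ (B' ∩ C)) + μ.real (A ∩ (B' ∩ C'))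

theorem integrable_and_integral_eq_correlation {Ω : Type*} [MeasurableSpace Ω] (μ : Measure Ω)
    [IsFiniteMeasure μ] {A A' B B' C C' : Set Ω} (hA : MeasurableSet A) (hA' : MeasurableSet A')
    (hB : MeasurableSet B) (hB' : MeasurableSet B') (hC : MeasurableSet C)
    (hC' : MeasurableSet C') :
    Integrable (fun ω => (A.indicator (1 : Ω → ℝ) ω * (B.indicator 1 ω - B'.indicator 1 ω)) *
      (A'.indicator 1 ω * (C.indicator 1 ω - C'.indicator 1 ω))) μ ∧
    ∫ ω, (A.indicator 1 ω * (B.indicator 1 ω - B'.indicator 1 ω)) *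
      (A'.indicator 1 ω * (C.indicator 1 ω - C'.indicator 1 ω)) ∂μ =
        correlation μ (A ∩ A') B B' C C' := by
  have hi : ∀ {S : Set Ω}, MeasurableSet S → Integrable (S.indicator (1 : Ω → ℝ)) μ := fun hS =>
    (integrable_const (1 : ℝ)).indicator hS
  have h1 := (hA.inter hA').inter (hB.inter hC)
  have h2 := (hA.inter hA').inter (hB.inter hC')
  have h3 := (hA.inter hA').inter (hB'.inter hC)
  have h4 := (hA.inter hA').inter (hB'.inter hC')
  have heq : (fun ω => (A.indicator (1 : Ω → ℝ) ω * (B.indicator 1 ω - B'.indicator 1 ω)) *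
      (A'.indicator 1 ω * (C.indicator 1 ω - C'.indicator 1 ω))) =
      (A ∩ A' ∩ (B ∩ C)).indicator 1 - (A ∩ A' ∩ (B ∩ C')).indicator 1 -
        (A ∩ A' ∩ (B' ∩ C)).indicator 1 + (A ∩ A' ∩ (B' ∩ C')).indicator 1 := by
    ext ω
    simp only [inter_indicator_one, Pi.mul_apply, Pi.sub_apply, Pi.add_apply]
    ring
  rw [heq]
  refine ⟨((((hi h1).sub (hi h2)).sub (hi h3)).add (hi h4)), ?_⟩
  rw [correlation, ← integral_indicator_one h1, ← integral_indicator_one h2,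
    ← integral_indicator_one h3, ← integral_indicator_one h4, ← integral_sub' (hi h1) (hi h2),
    ← integral_sub' ((hi h1).sub (hi h2)) (hi h3),
    ← integral_add' (((hi h1).sub (hi h2)).sub (hi h3)) (hi h4)]

theorem abs_correlation_le {Ω : Type*} [MeasurableSpace Ω] (μ : Measure Ω) [IsProbabilityMeasure μ]
    (A B B' C C' : Set Ω) : |correlation μ A B B' C C'| ≤ 2 := by
  have h : ∀ S : Set Ω, 0 ≤ μ.real S ∧ μ.real S ≤ 1 := fun S =>
    ⟨measureReal_nonneg, measureReal_le_one⟩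
  have h1 := h (A ∩ (B ∩ C))
  have h2 := h (A ∩ (B ∩ C'))
  have h3 := h (A ∩ (B' ∩ C))
  have h4 := h (A ∩ (B' ∩ C'))
  rw [correlation, abs_le]
  constructor <;> linarith

theorem correlation_swap {Ω : Type*} [MeasurableSpace Ω] (μ : Measure Ω) (A B B' C C' : Set Ω) :
    correlation μ A C C' B B' = correlation μ A B B' C C' := by
  simp only [correlation, inter_comm C, inter_comm C']
  ring

theorem tendsto_correlation (p : ℕ → unitInterval) {A B B' C C' : Set EdgeSpace}
    (hA : MeasurableSet A) (hB : MeasurableSet B) (hB' : MeasurableSet B') (hC : MeasurableSet C)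
    (hC' : MeasurableSet C') :
    Tendsto (fun n : ℕ => correlation (edgeMeasure p) A (shift n ⁻¹' B) (shift n ⁻¹' B')
      (shift n ⁻¹' C) (shift n ⁻¹' C')) atTop
      (𝓝 ((edgeMeasure p).real A * correlation (edgeMeasure p) univ B B' C C')) := by
  have h1 := tendsto_measureReal_inter_shift p hA (hB.inter hC)
  have h2 := tendsto_measureReal_inter_shift p hA (hB.inter hC')
  have h3 := tendsto_measureReal_inter_shift p hA (hB'.inter hC)
  have h4 := tendsto_measureReal_inter_shift p hA (hB'.inter hC')
  have := ((h1.sub h2).sub h3).add h4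
  simp only [correlation, univ_inter, mul_add, mul_sub]
  exact this

theorem correlation_shift (p : ℕ → unitInterval) {B B' C C' : Set EdgeSpace} (s : ℤ)
    (hB : MeasurableSet B) (hB' : MeasurableSet B') (hC : MeasurableSet C) (hC' : MeasurableSet C') :
    correlation (edgeMeasure p) univ (shift s ⁻¹' B) (shift s ⁻¹' B') (shift s ⁻¹' C)
      (shift s ⁻¹' C') = correlation (edgeMeasure p) univ B B' C C' := by
  simp only [correlation, univ_inter, ← preimage_inter]
  rw [measureReal_shift_preimage p s (hB.inter hC), measureReal_shift_preimage p s (hB.inter hC'),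
    measureReal_shift_preimage p s (hB'.inter hC), measureReal_shift_preimage p s (hB'.inter hC')]

/-- The event that `(-∞, j)` has type `t`. -/
def rightEvent (d : ℕ) (t : RankType d 0) (j : ℤ) : Set EdgeSpace :=
  {ω | intervalType d (Iio j) ω = t}

theorem measurableSet_rightEvent (d : ℕ) (t : RankType d 0) (j : ℤ) :
    MeasurableSet (rightEvent d t j) := measurableSet_rankType_eq _ _ _ _

theorem shift_preimage_rightEvent (d : ℕ) (t : RankType d 0) (s j : ℤ) :
    shift s ⁻¹' rightEvent d t j = rightEvent d t (j + s) := by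
  ext ω
  simp only [rightEvent, mem_preimage, mem_ofPred_eq, intervalType_shift, image_add_const_Iio]

/-- By mixing and stationarity all four probabilities tend to the square of the probability of
`rightEvent d t 0`, and they cancel in the signed sum. -/
theorem tendsto_correlation_rightEvent (p : ℕ → unitInterval) (d : ℕ) (t : RankType d 0) :
    Tendsto (fun n : ℕ => correlation (edgeMeasure p) univ (rightEvent d t 0) (rightEvent d t 1)
      (rightEvent d t n) (rightEvent d t (n + 1))) atTop (𝓝 0) := by
  have hm := measurableSet_rightEvent d t
  have h := fun i j => tendsto_measureReal_inter_shift p (hm i) (hm j)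
  have h01 : (edgeMeasure p).real (rightEvent d t 1) = (edgeMeasure p).real (rightEvent d t 0) := by
    rw [← measureReal_shift_preimage p 1 (hm 0), shift_preimage_rightEvent, zero_add]
  have := (((h 0 0).sub (h 0 1)).sub (h 1 0)).add (h 1 1)
  simp only [correlation, univ_inter]
  simp only [shift_preimage_rightEvent, h01, zero_add, sub_self, zero_sub, neg_add_cancel] at this
  simpa only [add_comm (1 : ℤ)] using this

/-- Distinct multiples of `s` are at least `s` apart, so stationarity reduces every pair to the
preceding limit. One `s` serves all types because they are finite in number. -/
theorem exists_abs_correlation_le (p : ℕ → unitInterval) (d : ℕ) {δ : ℝ} (hδ : 0 < δ) :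
    ∃ s : ℕ, ∀ (t : RankType d 0) (k k' : ℕ), k ≠ k' →
      |correlation (edgeMeasure p) univ (rightEvent d t (s * k)) (rightEvent d t (s * k + 1))
        (rightEvent d t (s * k')) (rightEvent d t (s * k' + 1))| ≤ δ := by
  have h : ∀ᶠ s : ℕ in atTop, ∀ n ≥ s, ∀ t : RankType d 0, |correlation (edgeMeasure p) univ
      (rightEvent d t 0) (rightEvent d t 1) (rightEvent d t n) (rightEvent d t (n + 1))| ≤ δ := by
    refine eventually_forall_ge_atTop.2 (eventually_all.2 fun t => ?_)
    filter_upwards [(tendsto_correlation_rightEvent p d t).abs.eventually_le_const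
      (by simpa using hδ)] with n hn using hn
  obtain ⟨s, hs⟩ := h.exists
  have key : ∀ (t : RankType d 0) (k k' : ℕ), k < k' →
      |correlation (edgeMeasure p) univ (rightEvent d t (s * k)) (rightEvent d t (s * k + 1))
        (rightEvent d t (s * k')) (rightEvent d t (s * k' + 1))| ≤ δ := by
    intro t k k' hk
    obtain ⟨l, rfl⟩ := Nat.exists_eq_add_of_lt hk
    have hm := measurableSet_rightEvent d t
    have := hs (s * (l + 1)) (Nat.le_mul_of_pos_right s (Nat.succ_pos l)) t
    rw [← correlation_shift p (s * k) (hm _) (hm _) (hm _) (hm _)] at this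
    simp only [shift_preimage_rightEvent] at this
    convert this using 3 <;> · congr 1; push_cast; ring
  refine ⟨s, fun t k k' hk => ?_⟩
  rcases lt_or_gt_of_ne hk with h | h
  · exact key t k k' h
  · rw [← correlation_swap]
    exact key t k' k h

/-- If `f` and `f'` depend on `(l, r)` and `(l, r')` through the same function, then their sums
differ at most as the empirical distributions of the pairs do. -/
theorem abs_sum_sub_le {ι Λ : Type*} [Fintype Λ] (S : Finset ι) (l r r' : ι → Λ) (f f' : ι → ℝ)
    (φ : Λ → Λ → ℝ) (hφ : ∀ a b, |φ a b| ≤ 1) (hf : ∀ i ∈ S, f i = φ (l i) (r i))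
    (hf' : ∀ i ∈ S, f' i = φ (l i) (r' i)) :
    |∑ i ∈ S, (f i - f' i)| ≤ ∑ a, ∑ b, |∑ i ∈ S, ({i | l i = a} : Set ι).indicator 1 i *
      (({i | r i = b} : Set ι).indicator (1 : ι → ℝ) i -
        ({i | r' i = b} : Set ι).indicator (1 : ι → ℝ) i)| := by
  classical
  -- Group the terms by the values of `(l, r)` and `(l, r')`; the coefficient of `φ a b` is the
  -- difference of the two counts.
  have h : ∑ i ∈ S, (f i - f' i) = ∑ a, ∑ b, φ a b * ∑ i ∈ S,
      ({i | l i = a} : Set ι).indicator 1 i * (({i | r i = b} : Set ι).indicator (1 : ι → ℝ) i -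
        ({i | r' i = b} : Set ι).indicator (1 : ι → ℝ) i) := by
    simp only [Finset.mul_sum]
    have hcomm : ∀ g : Λ → Λ → ι → ℝ, ∑ a, ∑ b, ∑ i ∈ S, g a b i = ∑ i ∈ S, ∑ a, ∑ b, g a b i :=
      fun g => by
        rw [Finset.sum_comm (s := S)]
        exact Finset.sum_congr rfl fun a _ => Finset.sum_comm
    rw [hcomm]
    refine Finset.sum_congr rfl fun i hi => ?_
    rw [hf i hi, hf' i hi]
    simp [Set.indicator, mul_sub, Finset.sum_sub_distrib]
  rw [h]
  refine (Finset.abs_sum_le_sum_abs _ _).trans (Finset.sum_le_sum fun a _ =>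
    (Finset.abs_sum_le_sum_abs _ _).trans (Finset.sum_le_sum fun b _ => ?_))
  rw [abs_mul]
  exact mul_le_of_le_one_left (abs_nonneg _) (hφ a b)

/-- The event that `[i, ∞)` has type `t`. -/
def leftEvent (d : ℕ) (t : RankType d 0) (i : ℤ) : Set EdgeSpace :=
  {ω | intervalType d (Ici i) ω = t}

theorem measurableSet_leftEvent (d : ℕ) (t : RankType d 0) (i : ℤ) :
    MeasurableSet (leftEvent d t i) := measurableSet_rankType_eq _ _ _ _

/-- With high probability the types of the long intervals with endpoints near `0` and `n` are
determined by the types of the two corresponding half-lines. -/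
theorem exists_intervalType_determined (p : ℕ → unitInterval) (hp : Summable fun i => (p i : ℝ))
    (d : ℕ) (P : Finset ℤ) : ∃ N : ℕ → Set EdgeSpace, (∀ n, MeasurableSet (N n)) ∧
      Tendsto (fun n => (edgeMeasure p).real (N n)) atTop (𝓝 0) ∧
      ∀ (n : ℕ), ∀ ω ∉ N n, ∀ i ∈ P, ∀ i' ∈ P, ∀ j ∈ P, ∀ j' ∈ P,
        intervalType d (Ici i) ω = intervalType d (Ici i') ω →
        intervalType d (Iio (j + n)) ω = intervalType d (Iio (j' + n)) ω →
        intervalType d (Ico i (j + n)) ω = intervalType d (Ico i' (j' + n)) ω := by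
  let L : (ℤ × ℤ) × ℤ → ℕ → Set EdgeSpace := fun q n =>
    {ω | intervalType d (Ici q.1.1) ω = intervalType d (Ici q.1.2) ω} ∩
      {ω | intervalType d (Ico q.1.1 (q.2 + n)) ω = intervalType d (Ico q.1.2 (q.2 + n)) ω}ᶜ
  let R : (ℤ × ℤ) × ℤ → ℕ → Set EdgeSpace := fun q n =>
    {ω | intervalType d (Iio (q.1.1 + n)) ω = intervalType d (Iio (q.1.2 + n)) ω} ∩
      {ω | intervalType d (Ico q.2 (q.1.1 + n)) ω = intervalType d (Ico q.2 (q.1.2 + n)) ω}ᶜ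
  have hmL : ∀ q n, MeasurableSet (L q n) := fun q n =>
    (measurableSet_intervalType_eq d _ _).inter (measurableSet_intervalType_eq d _ _).compl
  have hmR : ∀ q n, MeasurableSet (R q n) := fun q n =>
    (measurableSet_intervalType_eq d _ _).inter (measurableSet_intervalType_eq d _ _).compl
  refine ⟨fun n => ⋃ q ∈ (P ×ˢ P) ×ˢ P, (L q n ∪ R q n), fun n =>
    Finset.measurableSet_biUnion _ fun q _ => (hmL q n).union (hmR q n), ?_, ?_⟩
  · refine squeeze_zero (fun _ => measureReal_nonneg) (fun n =>
      (measureReal_biUnion_finset_le _ _).trans (Finset.sum_le_sum fun q _ =>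
        measureReal_union_le (L q n) (R q n))) ?_
    rw [show (0 : ℝ) = ∑ q ∈ (P ×ˢ P) ×ˢ P, (0 + 0) by simp]
    exact tendsto_finsetSum _ fun q _ =>
      (tendsto_measureReal_Ico_ne_of_Ici_eq p hp d q.1.1 q.1.2 q.2).add
        (tendsto_measureReal_Ico_ne_of_Iio_eq p hp d q.2 q.1.1 q.1.2)
  · intro n ω hω i hi i' hi' j hj j' hj' hl hr
    simp only [mem_iUnion, not_exists] at hω
    -- The endpoints are changed one at a time, passing through `[i', j + n)`.
    have h1 := hω ((i, i'), j) (by simp [hi, hi', hj])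
    have h2 := hω ((j, j'), i') (by simp [hi', hj, hj'])
    have h3 : intervalType d (Ico i (j + n)) ω = intervalType d (Ico i' (j + n)) ω :=
      by_contra fun h => h1 (Or.inl ⟨hl, h⟩)
    have h4 : intervalType d (Ico i' (j + n)) ω = intervalType d (Ico i' (j' + n)) ω :=
      by_contra fun h => h2 (Or.inr ⟨hr, h⟩)
    exact h3.trans h4

/-! ### The second moment of the discrepancy. -/

/-- The difference of the numbers of `k < V` at which the types of the half-lines at `s * k` and
at `s * k + n`, respectively `s * k + 1 + n`, are `a` and `b`. -/
noncomputable def discrepancy (d s V : ℕ) (a b : RankType d 0) (n : ℕ) (ω : EdgeSpace) : ℝ :=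
  ∑ k ∈ Finset.range V, (leftEvent d a (s * k)).indicator 1 ω *
    ((rightEvent d b (s * k + n)).indicator 1 ω - (rightEvent d b (s * k + 1 + n)).indicator 1 ω)

theorem discrepancy_sq (d s V : ℕ) (a b : RankType d 0) (n : ℕ) (ω : EdgeSpace) :
    discrepancy d s V a b n ω ^ 2 = ∑ k ∈ Finset.range V, ∑ k' ∈ Finset.range V,
      ((leftEvent d a (s * k)).indicator 1 ω *
        ((rightEvent d b (s * k + n)).indicator 1 ω -
          (rightEvent d b (s * k + 1 + n)).indicator 1 ω)) *
      ((leftEvent d a (s * k')).indicator 1 ω *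
        ((rightEvent d b (s * k' + n)).indicator 1 ω -
          (rightEvent d b (s * k' + 1 + n)).indicator 1 ω)) := by
  rw [discrepancy, sq, Finset.sum_mul_sum]

theorem integrable_discrepancy_sq (p : ℕ → unitInterval) (d s V : ℕ) (a b : RankType d 0) (n : ℕ) :
    Integrable (fun ω => discrepancy d s V a b n ω ^ 2) (edgeMeasure p) := by
  simp only [discrepancy_sq]
  exact integrable_finsetSum _ fun k _ => integrable_finsetSum _ fun k' _ =>
    (integrable_and_integral_eq_correlation _ (measurableSet_leftEvent _ _ _)
      (measurableSet_leftEvent _ _ _) (measurableSet_rightEvent _ _ _)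
      (measurableSet_rightEvent _ _ _) (measurableSet_rightEvent _ _ _)
      (measurableSet_rightEvent _ _ _)).1

/-- The half-lines involved overlap, so left and right types need not be independent. But the right
events are translates by `n` of fixed events, and mixing decouples them from the left events in the
limit. -/
theorem tendsto_integral_discrepancy_sq (p : ℕ → unitInterval) (d s V : ℕ) (a b : RankType d 0) :
    Tendsto (fun n => ∫ ω, discrepancy d s V a b n ω ^ 2 ∂edgeMeasure p) atTop
      (𝓝 (∑ k ∈ Finset.range V, ∑ k' ∈ Finset.range V,
        (edgeMeasure p).real (leftEvent d a (s * k) ∩ leftEvent d a (s * k')) *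
          correlation (edgeMeasure p) univ (rightEvent d b (s * k)) (rightEvent d b (s * k + 1))
            (rightEvent d b (s * k')) (rightEvent d b (s * k' + 1)))) := by
  have hl := measurableSet_leftEvent d a
  have hr := measurableSet_rightEvent d b
  have h := fun (n k k' : ℕ) => integrable_and_integral_eq_correlation (edgeMeasure p)
    (hl (s * k)) (hl (s * k')) (hr (s * k + n)) (hr (s * k + 1 + n)) (hr (s * k' + n))
    (hr (s * k' + 1 + n))
  have heq : ∀ n : ℕ, ∫ ω, discrepancy d s V a b n ω ^ 2 ∂edgeMeasure p =
      ∑ k ∈ Finset.range V, ∑ k' ∈ Finset.range V,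
        correlation (edgeMeasure p) (leftEvent d a (s * k) ∩ leftEvent d a (s * k'))
          (shift n ⁻¹' rightEvent d b (s * k)) (shift n ⁻¹' rightEvent d b (s * k + 1))
          (shift n ⁻¹' rightEvent d b (s * k')) (shift n ⁻¹' rightEvent d b (s * k' + 1)) := by
    intro n
    simp only [discrepancy_sq]
    rw [integral_finsetSum _ fun k _ => integrable_finsetSum _ fun k' _ => (h n k k').1]
    refine Finset.sum_congr rfl fun k _ => ?_
    rw [integral_finsetSum _ fun k' _ => (h n k k').1]
    refine Finset.sum_congr rfl fun k' _ => ?_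
    rw [(h n k k').2]
    simp only [shift_preimage_rightEvent]
  simp only [heq]
  exact tendsto_finsetSum _ fun k _ => tendsto_finsetSum _ fun k' _ =>
    tendsto_correlation p ((hl _).inter (hl _)) (hr _) (hr _) (hr _) (hr _)

/-- In the limiting double sum the `V` diagonal terms are at most `2` each and the others at most
`δ`, giving at most `2 * V + δ * V ^ 2`. Doubling `δ` supplies the strict inequality that passes to
large `n`. -/
theorem eventually_integral_discrepancy_sq_le (p : ℕ → unitInterval) {d s : ℕ} {δ : ℝ} (hδ : 0 < δ)
    (hs : ∀ (t : RankType d 0) (k k' : ℕ), k ≠ k' →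
      |correlation (edgeMeasure p) univ (rightEvent d t (s * k)) (rightEvent d t (s * k + 1))
        (rightEvent d t (s * k')) (rightEvent d t (s * k' + 1))| ≤ δ) (V : ℕ) (hV : 0 < V)
    (a b : RankType d 0) : ∀ᶠ n in atTop,
      ∫ ω, discrepancy d s V a b n ω ^ 2 ∂edgeMeasure p ≤ 2 * V + 2 * δ * V ^ 2 := by
  have hlim := tendsto_integral_discrepancy_sq p d s V a b
  refine (hlim.eventually_lt_const ?_).mono fun n hn => hn.le
  have hVpos : (0 : ℝ) < V := Nat.cast_pos.2 hV
  have hle : ∀ k k' : ℕ, (edgeMeasure p).real (leftEvent d a (s * k) ∩ leftEvent d a (s * k')) *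
      correlation (edgeMeasure p) univ (rightEvent d b (s * k)) (rightEvent d b (s * k + 1))
        (rightEvent d b (s * k')) (rightEvent d b (s * k' + 1)) ≤
      (if k = k' then 2 else 0) + δ := by
    intro k k'
    refine (le_abs_self _).trans ?_
    rw [abs_mul, abs_of_nonneg measureReal_nonneg]
    refine (mul_le_of_le_one_left (abs_nonneg _) measureReal_le_one).trans ?_
    split_ifs with h
    · exact (abs_correlation_le _ _ _ _ _ _).trans (by linarith)
    · rw [zero_add]; exact hs b k k' h
  refine (Finset.sum_le_sum fun k _ => Finset.sum_le_sum fun k' _ => hle k k').trans_lt ?_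
  have : ∑ k ∈ Finset.range V, ∑ k' ∈ Finset.range V, ((if k = k' then (2 : ℝ) else 0) + δ) =
      2 * V + δ * V ^ 2 := by
    simp only [Finset.sum_add_distrib, Finset.sum_const, Finset.card_range, nsmul_eq_mul,
      Finset.sum_ite_eq]
    rw [Finset.sum_congr rfl fun k hk => if_pos hk]
    simp only [Finset.sum_const, Finset.card_range, nsmul_eq_mul]
    ring
  rw [this]
  nlinarith [mul_pos hδ (pow_pos hVpos 2)]

/-! ### Averaging over starting points. -/

theorem measureReal_intervalType_shift (p : ℕ → unitInterval) (d : ℕ) (T : Set (RankType d 0))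
    (i m : ℤ) : (edgeMeasure p).real {ω | intervalType d (Ico i (i + m)) ω ∈ T} =
      (edgeMeasure p).real {ω | intervalType d (Ico 0 m) ω ∈ T} := by
  rw [← measureReal_shift_preimage p i (measurableSet_intervalType d (Ico 0 m) T)]
  simp only [preimage_ofPred_eq, intervalType_shift, image_add_const_Ico, zero_add, add_comm i]

theorem abs_sum_indicator_le {d s V : ℕ} {T : Set (RankType d 0)} {n : ℕ} {ω : EdgeSpace}
    [Fintype (RankType d 0)] (P : Finset ℤ) (hP : ∀ k ∈ Finset.range V, (s * k : ℤ) ∈ P)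
    (hP' : ∀ k ∈ Finset.range V, (s * k + 1 : ℤ) ∈ P)
    (h : ∀ i ∈ P, ∀ i' ∈ P, ∀ j ∈ P, ∀ j' ∈ P,
        intervalType d (Ici i) ω = intervalType d (Ici i') ω →
        intervalType d (Iio (j + n)) ω = intervalType d (Iio (j' + n)) ω →
        intervalType d (Ico i (j + n)) ω = intervalType d (Ico i' (j' + n)) ω) :
    |∑ k ∈ Finset.range V,
      ({ω | intervalType d (Ico (s * k) (s * k + n)) ω ∈ T}.indicator (1 : EdgeSpace → ℝ) ω -
        {ω | intervalType d (Ico (s * k) (s * k + 1 + n)) ω ∈ T}.indicator 1 ω)| ≤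
      ∑ a, ∑ b, |discrepancy d s V a b n ω| := by
  classical
  -- The rule for this fixed `ω`: by `h`, any endpoints in `P` with the given half-line types lead
  -- to the same answer. It serves both interval lengths.
  let φ : RankType d 0 → RankType d 0 → ℝ := fun a b =>
    if ∃ i ∈ P, ∃ j ∈ P, intervalType d (Ici i) ω = a ∧ intervalType d (Iio (j + n)) ω = b ∧
      intervalType d (Ico i (j + n)) ω ∈ T then 1 else 0
  have hφ : ∀ i ∈ P, ∀ j ∈ P,
      {ω | intervalType d (Ico i (j + n)) ω ∈ T}.indicator (1 : EdgeSpace → ℝ) ω =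
        φ (intervalType d (Ici i) ω) (intervalType d (Iio (j + n)) ω) := by
    intro i hi j hj
    simp only [φ, Set.indicator_apply, mem_ofPred_eq, Pi.one_apply]
    refine if_congr ⟨fun h' => ⟨i, hi, j, hj, rfl, rfl, h'⟩, ?_⟩ rfl rfl
    rintro ⟨i', hi', j', hj', h1, h2, h3⟩
    rwa [← h i' hi' i hi j' hj' j hj h1 h2]
  refine (abs_sum_sub_le (Finset.range V) (fun k : ℕ => intervalType d (Ici (s * k : ℤ)) ω)
    (fun k : ℕ => intervalType d (Iio (s * k + n : ℤ)) ω)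
    (fun k : ℕ => intervalType d (Iio (s * k + 1 + n : ℤ)) ω) _ _ φ (fun a b => ?_)
    (fun k hk => hφ _ (hP k hk) _ (hP k hk)) (fun k hk => hφ _ (hP k hk) _ (hP' k hk))).trans
    (le_of_eq ?_)
  · simp only [φ]
    split_ifs <;> simp
  · rfl

theorem tendsto_measureReal_intervalType_sub (p : ℕ → unitInterval)
    (hp : Summable fun i => (p i : ℝ)) (d : ℕ) (T : Set (RankType d 0)) :
    Tendsto (fun n : ℕ => (edgeMeasure p).real {ω | intervalType d (Ico 0 ((n + 1 : ℕ) : ℤ)) ω ∈ T} -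
      (edgeMeasure p).real {ω | intervalType d (Ico 0 (n : ℤ)) ω ∈ T}) atTop (𝓝 0) := by
  classical
  have := Fintype.ofFinite (RankType d 0)
  set μ := edgeMeasure p with hμ
  rw [Metric.tendsto_atTop']
  refine fun ε hε => eventually_atTop.1 ?_ |>.imp fun N hN n hn => hN n hn.le
  set K : ℝ := (Fintype.card (RankType d 0) : ℝ) * Fintype.card (RankType d 0) with hK
  have hK0 : 0 ≤ K := by positivity
  -- Chosen so that `η + K * (2 * η)` equals `ε / 2`: one `η` for the exceptional event and `2 * η`
  -- for each of the `K` pairs of types.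
  set η : ℝ := ε / (2 * (1 + 2 * K)) with hη
  have hη0 : 0 < η := by positivity
  have hηε : η + K * (2 * η) < ε := by
    have : η * (2 * (1 + 2 * K)) = ε := div_mul_cancel₀ _ (by positivity)
    nlinarith
  -- This size makes `2 * V` at most half of `η ^ 2 * V ^ 2`; the value `δ = η ^ 2 / 4` accounts for
  -- the other half. Both `V` and `s` are fixed before `n` grows.
  obtain ⟨V, hV⟩ := exists_nat_gt (4 / η ^ 2)
  have hV0 : (0 : ℝ) < V := lt_of_le_of_lt (by positivity) hV
  have hV1 : 2 * (V : ℝ) + 2 * (η ^ 2 / 4) * V ^ 2 ≤ η ^ 2 * V ^ 2 := by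
    rw [div_lt_iff₀ (by positivity)] at hV
    nlinarith
  obtain ⟨s, hs⟩ := exists_abs_correlation_le p d (δ := η ^ 2 / 4) (by positivity)
  set P : Finset ℤ := (Finset.range V).image (fun k : ℕ => (s * k : ℤ)) ∪
    (Finset.range V).image (fun k : ℕ => (s * k + 1 : ℤ)) with hP
  obtain ⟨N, hNm, hN0, hN⟩ := exists_intervalType_determined p hp d P
  have hsq : ∀ᶠ n in atTop, ∀ a b : RankType d 0,
      ∫ ω, discrepancy d s V a b n ω ^ 2 ∂μ ≤ 2 * V + 2 * (η ^ 2 / 4) * V ^ 2 :=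
    eventually_all.2 fun a => eventually_all.2 fun b =>
      eventually_integral_discrepancy_sq_le p (by positivity) hs V (Nat.cast_pos.1 hV0) a b
  filter_upwards [hsq, hN0.eventually_lt_const hη0] with n hn hNn
  have hi : ∀ {S : Set EdgeSpace}, MeasurableSet S → Integrable (S.indicator (1 : EdgeSpace → ℝ)) μ :=
    fun hS => (integrable_const (1 : ℝ)).indicator hS
  set q := μ.real {ω | intervalType d (Ico 0 (n : ℤ)) ω ∈ T} with hq
  set q' := μ.real {ω | intervalType d (Ico 0 ((n + 1 : ℕ) : ℤ)) ω ∈ T} with hq'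
  set F : EdgeSpace → ℝ := fun ω => ∑ k ∈ Finset.range V,
      ({ω | intervalType d (Ico (s * k) (s * k + n)) ω ∈ T}.indicator (1 : EdgeSpace → ℝ) ω -
        {ω | intervalType d (Ico (s * k) (s * k + 1 + n)) ω ∈ T}.indicator 1 ω) with hF
  have hFint : ∀ k : ℕ, Integrable (fun ω =>
      {ω | intervalType d (Ico (s * k) (s * k + n)) ω ∈ T}.indicator (1 : EdgeSpace → ℝ) ω -
        {ω | intervalType d (Ico (s * k) (s * k + 1 + n)) ω ∈ T}.indicator 1 ω) μ := fun k =>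
    (hi (measurableSet_intervalType d _ T)).sub (hi (measurableSet_intervalType d _ T))
  have hFi : Integrable F μ := integrable_finsetSum _ fun k _ => hFint k
  -- By stationarity every starting point contributes the same mean.
  have hint : ∫ ω, F ω ∂μ = V * (q - q') := by
    rw [integral_finsetSum _ fun k _ => hFint k]
    rw [Finset.sum_congr rfl fun k _ => show _ = q - q' from ?_]
    · rw [Finset.sum_const, Finset.card_range, nsmul_eq_mul]
    · rw [integral_sub (hi (measurableSet_intervalType d _ T))
        (hi (measurableSet_intervalType d _ T)),
        integral_indicator_one (measurableSet_intervalType d _ T),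
        integral_indicator_one (measurableSet_intervalType d _ T),
        measureReal_intervalType_shift, add_assoc, measureReal_intervalType_shift, hq, hq']
      push_cast
      rw [add_comm (1 : ℤ)]
  have hind : ∀ (S : Set EdgeSpace) ω, 0 ≤ S.indicator (1 : EdgeSpace → ℝ) ω ∧
      S.indicator (1 : EdgeSpace → ℝ) ω ≤ 1 := fun S ω =>
    ⟨indicator_nonneg (fun _ _ => zero_le_one) ω, indicator_le_self' (fun _ _ => zero_le_one) ω⟩
  have hpt : ∀ ω, |F ω| ≤ V * (N n).indicator 1 ω +
      ∑ a, ∑ b, (discrepancy d s V a b n ω ^ 2 / (V * η) + V * η) := by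
    intro ω
    have hc : 0 < V * η := by positivity
    -- The elementary bound `|x| ≤ x ^ 2 / c + c` with `c = V * η` replaces Cauchy–Schwarz: a second
    -- moment at most `c ^ 2` gives a first moment at most `2 * c`.
    have hterm : ∀ a b, |discrepancy d s V a b n ω| ≤
        discrepancy d s V a b n ω ^ 2 / (V * η) + V * η := by
      intro a b
      rw [← sq_abs, div_add' _ _ _ hc.ne', le_div_iff₀ hc]
      nlinarith [sq_nonneg (|discrepancy d s V a b n ω| - V * η), abs_nonneg (discrepancy d s V a b n ω)]
    by_cases hω : ω ∈ N n
    · have h1 : |F ω| ≤ V := by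
        refine (Finset.abs_sum_le_sum_abs _ _).trans ((Finset.sum_le_sum fun k _ =>
          show _ ≤ (1 : ℝ) from ?_).trans (by simp))
        exact abs_sub_le_of_nonneg_of_le (hind _ ω).1 (hind _ ω).2 (hind _ ω).1 (hind _ ω).2
      rw [indicator_of_mem hω, Pi.one_apply, mul_one]
      exact h1.trans (le_add_of_nonneg_right (Finset.sum_nonneg fun a _ => Finset.sum_nonneg
        fun b _ => (abs_nonneg _).trans (hterm a b)))
    · rw [indicator_of_notMem hω, mul_zero, zero_add]
      refine (abs_sum_indicator_le P (fun k hk => ?_) (fun k hk => ?_) (hN n ω hω)).trans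
        (Finset.sum_le_sum fun a _ => Finset.sum_le_sum fun b _ => hterm a b)
      · exact Finset.mem_union_left _ (Finset.mem_image_of_mem _ hk)
      · exact Finset.mem_union_right _ (Finset.mem_image_of_mem _ hk)
  have hDi : ∀ a b, Integrable (fun ω => discrepancy d s V a b n ω ^ 2 / (V * η) + V * η) μ :=
    fun a b => ((integrable_discrepancy_sq p d s V a b n).div_const _).add (integrable_const _)
  have hDs : Integrable (fun ω => ∑ a, ∑ b, (discrepancy d s V a b n ω ^ 2 / (V * η) + V * η)) μ :=
    integrable_finsetSum _ fun a _ => integrable_finsetSum _ fun b _ => hDi a b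
  have hmain : |V * (q - q')| ≤ V * μ.real (N n) + K * (2 * (V * η)) := by
    rw [← hint]
    refine (abs_integral_le_integral_abs).trans
      ((integral_mono hFi.abs (((hi (hNm n)).const_mul _).add hDs) hpt).trans ?_)
    simp only [Pi.add_apply]
    rw [integral_add ((hi (hNm n)).const_mul _) hDs, integral_const_mul,
      integral_indicator_one (hNm n)]
    refine add_le_add_right ?_ _
    rw [integral_finsetSum _ fun a _ => integrable_finsetSum _ fun b _ => hDi a b]
    calc _ ≤ ∑ a : RankType d 0, ∑ b : RankType d 0, 2 * (V * η) := by
          refine Finset.sum_le_sum fun a _ => ?_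
          rw [integral_finsetSum _ fun b _ => hDi a b]
          refine Finset.sum_le_sum fun b _ => ?_
          rw [integral_add ((integrable_discrepancy_sq p d s V a b n).div_const _)
            (integrable_const _), integral_div, integral_const, probReal_univ, one_smul]
          have : (∫ ω, discrepancy d s V a b n ω ^ 2 ∂μ) / (V * η) ≤ V * η := by
            rw [div_le_iff₀ (by positivity)]
            have := hn a b
            nlinarith
          linarith
      _ = K * (2 * (V * η)) := by
          simp only [Finset.sum_const, Finset.card_univ, nsmul_eq_mul, hK, mul_assoc]
  rw [abs_mul, abs_of_pos hV0] at hmain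
  rw [Real.dist_eq, sub_zero, abs_sub_comm]
  have : V * |q - q'| ≤ V * (μ.real (N n) + K * (2 * η)) := by linarith
  have := le_of_mul_le_mul_left this hV0
  linarith

end OrderedRandomGraph

theorem theorem1p4 (p : ℕ → unitInterval) (hp : Summable fun i => (p i : ℝ))
    (ψ : OrderedRandomGraph.language.Sentence) :
    Filter.Tendsto
      (fun n : ℕ => OrderedRandomGraph.prob p (n + 1) ψ - OrderedRandomGraph.prob p n ψ)
      Filter.atTop (nhds 0) := by
  obtain ⟨d, T, h⟩ := OrderedRandomGraph.exists_models_iff ψ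
  simp only [OrderedRandomGraph.prob_eq_measureReal, h]
  exact OrderedRandomGraph.tendsto_measureReal_intervalType_sub p hp d T
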